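/- **Theorem (reality of tree-level wavefunction coefficients of massless scalar EFTs in de Sitter space).** *Setting.* Let $H>0$, and let $\tau<0$ be conformal time and $\vec x\in\mathbb R^3$ comoving position in exact de Sitter space, $ds^2=(H\tau)^{-2}(-d\tau^2+d\vec x^2)$. An EFT of real massless scalars $\varphi_f$ (the flavours $f$ range over an arbitrary set) is given by a set of local interactions. A local interaction is a Lagrangian density $L$ (per $d\tau\,d^3x$) that is a polynomial in the fields and their derivatives $\partial_\tau^n\partial_{\vec x}^{\alpha}\varphi_f(\tau,\vec x)$, with coefficients that are functions of $\tau$, real for $\tau<0$ and holomorphic for $\operatorname{Re}\tau<0$. Assume that every interaction of the EFT is invariant under parity, rotations and dilations: for all smooth real fields, $L[\varphi\circ g](\tau,\vec x)=L[\varphi](g(\tau,\vec x))$ for $g(\tau,\vec x)=(\tau,-\vec x)$ and for $g(\tau,\vec x)=(\tau,R\vec x)$ with $R\in SO(3)$, and $L[\varphi\circ g](\tau,\vec x)=\lambda^4L[\varphi](g(\tau,\vec x))$ for $g(\tau,\vec x)=(\lambda\tau,\lambda\vec x)$ with $\lambda>0$. *Diagrams.* Consider a connected tree diagram with vertex set $\mathcal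 V$, external lines $\mathcal E$ ($|\mathcal E|=E$) and internal lines $\mathcal I$. Each vertex carries an interaction $L_v$ of the EFT, each line a flavour and a nonzero momentum $\vec k$ with $k=|\vec k|$, and momentum is conserved at every vertex. The contribution of the diagram to the wavefunction coefficient $\tilde\psi_E$ is $$\tilde\psi_E=\int_{-\infty(1-i\epsilon)}^{0}\ \prod_{v\in\mathcal V} i\,d\tau_v\,D_v\ \prod_{e\in\mathcal E}K_e\ \prod_{e'\in\mathcal I}G_{e'},\qquad \epsilon\to0^+ .$$ Here $D_v$ contracts the lines at $v$ in all possible ways with the factors $\partial_\tau^n\partial_{\vec x}^\alpha\varphi_f$ (of matching flavour) of the monomials of $L_v$. The derivative $\partial_{\vec x}$ becomes $i$ times the momentum that enters $v$, and $\partial_\tau$ acts on the propagator, where $$K(k,\tau)=(1-ik\tau)e^{ik\tau},$$ $$G(k,\tau_1,\tau_2)=\tfrac{H^2}{2k^3}(1+ik\tau_1)(1-ik\tau_2)e^{-ik(\tau_1-\tau_2)}\Theta(\tau_1-\tau_2)+(\tau_1\leftrightarrow\tau_2)-\tfrac{H^2}{2k^3}(1-ik\tau_1)(1-ik\tau_2)e^{ik(\tau_1+\tau_2)}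 .$$ On the contour $\tau_v=-(1-i\epsilon)s_v$, $s_v>0$, times are ordered by the parameters $s_v$. Time derivatives act on the mode functions and on $\Theta$, so that contact terms ($\delta$-functions and their derivatives) are included. Precisely, $\Theta(\tau_1-\tau_2)$ is replaced by $\theta(\sigma^{-1}\log(s_2/s_1))$, where $\theta:\mathbb R\to\mathbb R$ is smooth, $\theta(u)=0$ for $u\le-1$, $\theta(u)=1$ for $u\ge1$ and $\theta(u)+\theta(-u)=1$, and the limit $\sigma\to0^+$ of the integral is taken before $\epsilon\to0^+$. The diagram *converges* with value $\tilde\psi_E$ if, for all small $\epsilon>0$, the integral converges absolutely for all small $\sigma>0$ (depending on $\epsilon$), and the limits $\sigma\to0^+$ and then $\epsilon\to0^+$ exist and give $\tilde\psi_E$. *Claim.* For every choice of $\theta$, the value $\tilde\psi_E$ of every convergent connected tree diagram of the EFT is real. -/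

import Mathlib

open Filter Topology MeasureTheory
open scoped ContDiff

noncomputable section

namespace DeSitter

/-! ### Local interactions and their symmetries -/

/-- Comoving space. A spacetime point is a pair `(τ, x) : ℝ × Space`, with conformal time `τ < 0`. -/
abbrev Space := EuclideanSpace ℝ (Fin 3)

/-- The jet variable `(f, n, α)` stands for `∂_τ^n ∂_1^{α 0} ∂_2^{α 1} ∂_3^{α 2} φ_f`, where `f`
is a flavour. -/
abbrev Jet (ι : Type*) := ι × ℕ × (Fin 3 → ℕ)

/-- The derivative of a function on spacetime in the direction `v`. -/
def partialDeriv (v : ℝ × Space) (f : ℝ × Space → ℝ) : ℝ × Space → ℝ :=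
  fun p => fderiv ℝ f p v

/-- The unit vector in the time direction. -/
def timeDir : ℝ × Space := (1, 0)

/-- The unit vector in the `i`-th spatial direction. -/
def spaceDir (i : Fin 3) : ℝ × Space := (0, EuclideanSpace.single i 1)

/-- The value of a jet variable on a field configuration. -/
def jetValue {ι : Type*} (φ : ι → ℝ × Space → ℝ) (J : Jet ι) : ℝ × Space → ℝ :=
  (partialDeriv timeDir)^[J.2.1]
    ((partialDeriv (spaceDir 0))^[J.2.2 0]
      ((partialDeriv (spaceDir 1))^[J.2.2 1]
        ((partialDeriv (spaceDir 2))^[J.2.2 2] (φ J.1))))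

/-- A local interaction: a Lagrangian density (per `dτ d³x`) which is a polynomial in the real
fields and their derivatives at a point, with coefficients that may depend on conformal time.
The coefficients are real for `τ < 0`, and they are holomorphic for `Re τ < 0`, so that they can
be evaluated on the tilted time contour. -/
structure LocalInteraction (ι : Type*) where
  lag : MvPolynomial (Jet ι) (ℂ → ℂ)
  holomorphic : ∀ m, DifferentiableOn ℂ (lag.coeff m) {τ : ℂ | τ.re < 0}
  real : ∀ m, ∀ τ : ℝ, τ < 0 → (lag.coeff m (τ : ℂ)).im = 0

namespace LocalInteraction

variable {ι : Type*}

/-- The Lagrangian density of the field configuration `φ` at the spacetime point `p`. -/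
def density (O : LocalInteraction ι) (φ : ι → ℝ × Space → ℝ) (p : ℝ × Space) : ℂ :=
  O.lag.eval₂ (Pi.evalRingHom (fun _ : ℂ => ℂ) (p.1 : ℂ)) (fun J => (jetValue φ J p : ℂ))

/-- Invariance under the spatial reflection `x ↦ -x`. -/
def ParityInvariant (O : LocalInteraction ι) : Prop :=
  ∀ φ : ι → ℝ × Space → ℝ, (∀ f, ContDiff ℝ ∞ (φ f)) → ∀ p : ℝ × Space, p.1 < 0 →
    O.density (fun f q => φ f (q.1, -q.2)) p = O.density φ (p.1, -p.2)

/-- Invariance under the rotations `x ↦ R x`. -/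
def RotationInvariant (O : LocalInteraction ι) : Prop :=
  ∀ R : Space ≃ₗᵢ[ℝ] Space, LinearMap.det (R.toLinearEquiv : Space →ₗ[ℝ] Space) = 1 →
    ∀ φ : ι → ℝ × Space → ℝ, (∀ f, ContDiff ℝ ∞ (φ f)) → ∀ p : ℝ × Space, p.1 < 0 →
      O.density (fun f q => φ f (q.1, R q.2)) p = O.density φ (p.1, R p.2)

/-- Invariance under the de Sitter dilations `(τ, x) ↦ (l τ, l x)`: the form `L dτ d³x` is
invariant. -/
def DilationInvariant (O : LocalInteraction ι) : Prop :=
  ∀ l : ℝ, 0 < l →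
    ∀ φ : ι → ℝ × Space → ℝ, (∀ f, ContDiff ℝ ∞ (φ f)) → ∀ p : ℝ × Space, p.1 < 0 →
      O.density (fun f q => φ f (l • q)) p = (l : ℂ) ^ 4 * O.density φ (l • p)

end LocalInteraction

/-! ### Propagators on the tilted time contour -/

/-- The direction `1 - iε` of the contour. -/
def tilt (ε : ℝ) : ℂ := 1 - Complex.I * ε

/-- The contour from `-∞ (1 - iε)` to `0`: the conformal time `τ = -(1 - iε) s`, for `s > 0`. -/
def contour (ε s : ℝ) : ℂ := -(tilt ε * s)

/-- `∂_τ^n` of a function on the contour, written in the parameter `s`. -/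
def tauDeriv (ε : ℝ) (n : ℕ) (f : ℝ → ℂ) (s : ℝ) : ℂ :=
  (-(1 / tilt ε)) ^ n * iteratedDeriv n f s

/-- The massless bulk-to-boundary propagator `(1 - ikτ) e^{ikτ}`. -/
def bulkToBoundary (k : ℝ) (τ : ℂ) : ℂ :=
  (1 - Complex.I * k * τ) * Complex.exp (Complex.I * k * τ)

/-- The massless Wightman function `v_k(τ₁) v_k(τ₂)^*`, continued analytically in both times;
`v_k(τ) = (H / √(2k³)) (1 + ikτ) e^{-ikτ}`. -/
def wightman (H k : ℝ) (τ₁ τ₂ : ℂ) : ℂ :=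
  (H ^ 2 / (2 * k ^ 3) : ℝ) * (1 + Complex.I * k * τ₁) * (1 - Complex.I * k * τ₂) *
    Complex.exp (-(Complex.I * k * (τ₁ - τ₂)))

/-- The part of the bulk-to-bulk propagator that restores the Dirichlet condition at `τ = 0`. -/
def boundaryTerm (H k : ℝ) (τ₁ τ₂ : ℂ) : ℂ :=
  (H ^ 2 / (2 * k ^ 3) : ℝ) * (1 - Complex.I * k * τ₁) * (1 - Complex.I * k * τ₂) *
    Complex.exp (Complex.I * k * (τ₁ + τ₂))

/-- A smooth profile that approximates the step function `Θ` when its argument is rescaled. -/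
structure StepProfile where
  toFun : ℝ → ℝ
  smooth : ContDiff ℝ ∞ toFun
  eq_zero : ∀ u ≤ -1, toFun u = 0
  eq_one : ∀ u, 1 ≤ u → toFun u = 1
  symm : ∀ u, toFun u + toFun (-u) = 1

/-- The smoothed `Θ(τ₁ - τ₂)` in the contour parameters `s₁, s₂ > 0`. For `τ = -(1 - iε) s` the
time `τ₁` is later than `τ₂` exactly if `log (s₂ / s₁) > 0`; the exact step function is the limit
`σ → 0⁺`, and derivatives of `Θ` (delta functions and their derivatives) are the limits of the
derivatives. -/
def smoothStep (θ : StepProfile) (σ s₁ s₂ : ℝ) : ℝ :=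
  θ.toFun (Real.log (s₂ / s₁) / σ)

/-- The massless bulk-to-bulk propagator on the contour, with smoothed time ordering. -/
def bulkToBulk (H : ℝ) (θ : StepProfile) (ε σ k s₁ s₂ : ℝ) : ℂ :=
  wightman H k (contour ε s₁) (contour ε s₂) * smoothStep θ σ s₁ s₂
    + wightman H k (contour ε s₂) (contour ε s₁) * smoothStep θ σ s₂ s₁
    - boundaryTerm H k (contour ε s₁) (contour ε s₂)

/-- `∂_{τ₁}^n ∂_{τ₂}^m` of the bulk-to-bulk propagator. The derivatives act on the (smoothed) step
functions as well as on the mode functions. -/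
def bulkToBulkDeriv (H : ℝ) (θ : StepProfile) (ε σ k : ℝ) (n m : ℕ) (s₁ s₂ : ℝ) : ℂ :=
  tauDeriv ε n (fun u₁ => tauDeriv ε m (fun u₂ => bulkToBulk H θ ε σ k u₁ u₂) s₂) s₁

/-! ### Tree diagrams -/

/-- The vertex at which a half-edge ends. The half-edges are the external lines (indexed by
`Fin E`) and the two ends of each internal line (the darts of the graph; the dart from `v` to `w`
is the end at `v` of the line that joins `v` and `w`). -/
def halfEdgeVertex {E V : ℕ} {G : SimpleGraph (Fin V)} (attach : Fin E → Fin V) :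
    Fin E ⊕ G.Dart → Fin V
  | Sum.inl e => attach e
  | Sum.inr d => d.fst

open Classical in
/-- A connected tree diagram with `E` external lines. Each vertex carries a local interaction,
each line a flavour and a nonzero momentum. `momentum h` is the momentum that enters the vertex
through the half-edge `h`; it is conserved at every vertex. -/
structure TreeDiagram (ι : Type*) (E : ℕ) where
  V : ℕ
  graph : SimpleGraph (Fin V)
  isTree : graph.IsTree
  attach : Fin E → Fin V
  interaction : Fin V → LocalInteraction ι
  flavor : Fin E ⊕ graph.Dart → ι
  flavor_symm : ∀ d : graph.Dart, flavor (Sum.inr d.symm) = flavor (Sum.inr d)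
  momentum : Fin E ⊕ graph.Dart → Space
  momentum_symm : ∀ d : graph.Dart, momentum (Sum.inr d.symm) = -momentum (Sum.inr d)
  momentum_ne_zero : ∀ h, momentum h ≠ 0
  momentum_conservation : ∀ v : Fin V,
    ∑ h ∈ Finset.univ.filter (fun h => halfEdgeVertex attach h = v), momentum h = 0

namespace TreeDiagram

variable {ι : Type*} {E : ℕ}

/-- The vertex at which a half-edge of the diagram ends. -/
def vertex (D : TreeDiagram ι E) : Fin E ⊕ D.graph.Dart → Fin D.V :=
  halfEdgeVertex D.attach

open Classical in
/-- The ways to let each half-edge be contracted with a factor `∂_τ^n ∂^α φ_f` of the interaction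
at its vertex, where `f` has to be the flavour of the line. -/
def contractions (D : TreeDiagram ι E) : Finset (Fin E ⊕ D.graph.Dart → Jet ι) :=
  Fintype.piFinset fun h =>
    (D.interaction (D.vertex h)).lag.vars.filter (fun J => J.1 = D.flavor h)

open Classical in
/-- The product of the factors that are contracted at the vertex `v`, as a monomial. -/
def vertexMonomial (D : TreeDiagram ι E) (j : Fin E ⊕ D.graph.Dart → Jet ι) (v : Fin D.V) :
    Jet ι →₀ ℕ :=
  ∑ h ∈ Finset.univ.filter (fun h => D.vertex h = v), Finsupp.single (j h) 1

/-- The factor of the vertex `v` at contour parameter `s`: `i dτ/ds` times the coefficient of the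
monomial in the interaction, times the number of ways to match equal factors with half-edges.
This is `i dτ/ds` times the derivative of the Lagrangian with respect to the jet variables
`j h` (`h` at `v`), at vanishing field. -/
def vertexFactor (D : TreeDiagram ι E) (ε : ℝ) (j : Fin E ⊕ D.graph.Dart → Jet ι) (v : Fin D.V)
    (s : ℝ) : ℂ :=
  Complex.I * tilt ε * ((D.vertexMonomial j v).prod fun _ n => (Nat.factorial n : ℂ)) *
    (D.interaction v).lag.coeff (D.vertexMonomial j v) (contour ε s)

/-- The spatial derivatives in momentum space: `∂_a` becomes `i p_a`. -/
def momentumFactor (p : Space) (α : Fin 3 → ℕ) : ℂ :=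
  ∏ a : Fin 3, (Complex.I * (p a : ℂ)) ^ α a

open Classical in
/-- The integrand of the diagram: all contractions of the vertex operators with the
bulk-to-boundary propagators of the external lines and the bulk-to-bulk propagators of the
internal lines (each internal line is one dart `d` with `d.fst < d.snd`). -/
def integrand (D : TreeDiagram ι E) (H : ℝ) (θ : StepProfile) (ε σ : ℝ) (s : Fin D.V → ℝ) : ℂ :=
  ∑ j ∈ D.contractions,
    (∏ v, D.vertexFactor ε j v (s v)) *
    (∏ h, momentumFactor (D.momentum h) (j h).2.2) *
    (∏ e : Fin E, tauDeriv ε (j (Sum.inl e)).2.1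
      (fun u => bulkToBoundary ‖D.momentum (Sum.inl e)‖ (contour ε u)) (s (D.attach e))) *
    (∏ d ∈ Finset.univ.filter (fun d : D.graph.Dart => d.fst < d.snd),
      bulkToBulkDeriv H θ ε σ ‖D.momentum (Sum.inr d)‖
        (j (Sum.inr d)).2.1 (j (Sum.inr d.symm)).2.1 (s d.fst) (s d.snd))

/-- The range of the contour parameters of the vertices. -/
def domain (D : TreeDiagram ι E) : Set (Fin D.V → ℝ) := {s | ∀ v, 0 < s v}

/-- The diagram converges and its value is `ψ`: the integrals over the vertex times along the
contour converge absolutely, and the smoothing of the step functions (`σ → 0⁺`) and then the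
tilt of the contour (`ε → 0⁺`) can be removed, with the limit `ψ`. -/
def HasValue (D : TreeDiagram ι E) (H : ℝ) (θ : StepProfile) (ψ : ℂ) : Prop :=
  (∀ᶠ ε in 𝓝[>] (0 : ℝ), ∀ᶠ σ in 𝓝[>] (0 : ℝ),
    IntegrableOn (D.integrand H θ ε σ) D.domain) ∧
  ∃ Ψ : ℝ → ℂ,
    (∀ᶠ ε in 𝓝[>] (0 : ℝ),
      Tendsto (fun σ => ∫ s in D.domain, D.integrand H θ ε σ s) (𝓝[>] 0) (𝓝 (Ψ ε))) ∧
    Tendsto Ψ (𝓝[>] 0) (𝓝 ψ)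

end TreeDiagram

end DeSitter

end

/-! The proof is a Wick rotation of the overall scale of the times. Put `τ = i x`; on the contour `x
= ζ s` with `ζ = ε + i`. In terms of `x` the propagators are real: `K = (1 + k x) e^{-k x}`, and
likewise for `G`, whose time ordering depends only on the ratio `s₂ / s₁`.

It remains to count phases. Dilation invariance forces the coefficient of a monomial with `n`
derivatives to be a real multiple of `(-τ)^(n-4) = (-i x)^(n-4)`, which has phase `(-i)^n` because
`i^4 = 1` (`coeff_scaling`, `coeff_eq_zpow`). Every `∂_τ = -i ∂_x` contributes `-i`, every spatial
derivative contributes `i`, and `i dτ` becomes `ζ ds = dx`. A half-edge with `a` time and `b`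
spatial derivatives therefore has total phase `(-i)^(a+b) i^b (-i)^a = (-1)^a`, which is real
(`phase_halfEdge`).

The smoothed step functions are not analytic, so the times cannot be rotated independently. On a ray
`s = r w`, however, all ratios of times are constant, and the integrand with its polar Jacobian is
`ζ` times a finite real combination of terms `u^p e^{-a u}` at `u = ζ r` (`exists_integrand_ray`).
Since `Re ζ = ε > 0`, Cauchy's theorem rotates this ray to the positive real axis, where the
integrand is real (`ray_integral_im`). The arcs at infinity and at the origin vanish because
integrability along the one ray already controls the exponential sum in both places.

Fubini in polar coordinates then gives a real regularized integral, and reality survives the limits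
`σ → 0⁺` and `ε → 0⁺`. -/

noncomputable section

namespace DeSitter

/-! ### Real exponential sums and rotation of rays -/

/-- The function `u ↦ u ^ p * exp (-a u)`, for the index `(a, p)`. -/
def expTerm (i : ℝ × ℤ) (u : ℂ) : ℂ := u ^ i.2 * Complex.exp (-(i.1 * u))

/-- A finite real linear combination of the functions `u ^ p * exp (-a u)`. -/
def expSum (c : ℝ × ℤ →₀ ℝ) (u : ℂ) : ℂ := c.sum fun i b => (b : ℂ) * expTerm i u

lemma expSum_eq (c : ℝ × ℤ →₀ ℝ) (u : ℂ) :
    expSum c u = ∑ i ∈ c.support, (c i : ℂ) * expTerm i u := rfl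

lemma norm_expTerm (i : ℝ × ℤ) (u : ℂ) :
    ‖expTerm i u‖ = ‖u‖ ^ i.2 * Real.exp (-(i.1 * u.re)) := by
  simp [expTerm, Complex.norm_exp]

lemma expTerm_ne_zero (i : ℝ × ℤ) {u : ℂ} (hu : u ≠ 0) : expTerm i u ≠ 0 :=
  mul_ne_zero (zpow_ne_zero _ hu) (Complex.exp_ne_zero _)

lemma differentiableAt_expSum (c : ℝ × ℤ →₀ ℝ) {u : ℂ} (hu : u ≠ 0) :
    DifferentiableAt ℂ (expSum c) u := by
  unfold expSum Finsupp.sum expTerm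
  refine DifferentiableAt.fun_sum fun i _ => ?_
  have : DifferentiableAt ℂ (fun u : ℂ => u ^ i.2) u := differentiableAt_zpow.2 (Or.inl hu)
  fun_prop

lemma meromorphicAt_expSum (c : ℝ × ℤ →₀ ℝ) : MeromorphicAt (expSum c) 0 := by
  unfold expSum Finsupp.sum expTerm
  refine MeromorphicAt.fun_sum fun i _ => ?_
  refine (MeromorphicAt.const _ _).mul (((MeromorphicAt.id 0).zpow _).mul ?_)
  exact AnalyticAt.meromorphicAt (by fun_prop)

lemma expSum_ofReal_im (c : ℝ × ℤ →₀ ℝ) (x : ℝ) : (expSum c x).im = 0 := by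
  rw [expSum_eq, Complex.im_sum]
  refine Finset.sum_eq_zero fun i _ => ?_
  have : (c i : ℂ) * expTerm i x = ((c i * (x ^ i.2 * Real.exp (-(i.1 * x))) : ℝ) : ℂ) := by
    simp [expTerm]
  rw [this, Complex.ofReal_im]

/-- Comparison of growth of `r ^ q * exp (-b r)` at infinity. -/
lemma tendsto_zpow_mul_exp_atTop {b : ℝ} {q : ℤ} (h : 0 < b ∨ b = 0 ∧ q < 0) :
    Tendsto (fun r : ℝ => r ^ q * Real.exp (-(b * r))) atTop (𝓝 0) := by
  rcases h with hb | ⟨rfl, hq⟩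
  · refine (tendsto_rpow_mul_exp_neg_mul_atTop_nhds_zero q b hb).congr fun r => ?_
    rw [Real.rpow_intCast, neg_mul]
  · simpa using tendsto_zpow_atTop_zero hq

lemma tendsto_norm_expTerm_ray {ζ : ℂ} (hζ : 0 < ζ.re) {b : ℝ} {q : ℤ}
    (h : 0 < b ∨ b = 0 ∧ q < 0) :
    Tendsto (fun r : ℝ => ‖expTerm (b, q) (ζ * r)‖) atTop (𝓝 0) := by
  have h' : 0 < b * ζ.re ∨ b * ζ.re = 0 ∧ q < 0 := by
    rcases h with h | ⟨rfl, h⟩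
    · exact Or.inl (by positivity)
    · exact Or.inr ⟨by simp, h⟩
  have := (tendsto_zpow_mul_exp_atTop h').const_mul (‖ζ‖ ^ q)
  rw [mul_zero] at this
  refine this.congr' ?_
  filter_upwards [eventually_gt_atTop 0] with r hr
  rw [norm_expTerm, norm_mul, Complex.norm_real, Real.norm_of_nonneg hr.le, mul_zpow]
  simp only [Complex.mul_re, Complex.ofReal_re, Complex.ofReal_im, mul_zero, sub_zero]
  ring_nf

lemma expTerm_div (i j : ℝ × ℤ) {u : ℂ} (hu : u ≠ 0) :
    expTerm i u / expTerm j u = expTerm (i.1 - j.1, i.2 - j.2) u := by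
  simp only [expTerm, zpow_sub₀ hu]
  rw [show -(((i.1 - j.1 : ℝ) : ℂ) * u) = -(i.1 * u) - -(j.1 * u) by push_cast; ring,
    Complex.exp_sub]
  have := Complex.exp_ne_zero (-(j.1 * u))
  have := zpow_ne_zero j.2 hu
  field_simp

/-- The leading index at infinity: the smallest exponent, and then the largest power. -/
lemma exists_leading (c : ℝ × ℤ →₀ ℝ) (hc : c ≠ 0) :
    ∃ j ∈ c.support, ∀ i ∈ c.support, i ≠ j → 0 < i.1 - j.1 ∨ i.1 - j.1 = 0 ∧ i.2 - j.2 < 0 := by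
  obtain ⟨j, hj, hmin⟩ := Finset.exists_min_image c.support
    (fun i => toLex (i.1, -i.2)) (Finsupp.support_nonempty_iff.2 hc)
  refine ⟨j, hj, fun i hi hij => ?_⟩
  have h := hmin i hi
  rw [Prod.Lex.toLex_le_toLex] at h
  rcases h with h | ⟨h1, h2⟩
  · exact Or.inl (sub_pos.2 h)
  · simp only at h1 h2
    refine Or.inr ⟨by linarith, ?_⟩
    have : i.2 ≠ j.2 := fun h => hij (Prod.ext h1.symm h)
    omega

/-- Along a ray in the right half plane, an exponential sum dominates its leading term. -/
lemma leading_isBigO (c : ℝ × ℤ →₀ ℝ) {j : ℝ × ℤ} (hj : j ∈ c.support)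
    (hlead : ∀ i ∈ c.support, i ≠ j → 0 < i.1 - j.1 ∨ i.1 - j.1 = 0 ∧ i.2 - j.2 < 0)
    {ζ : ℂ} (hζ : 0 < ζ.re) :
    (fun r : ℝ => expTerm j (ζ * r)) =O[atTop] fun r : ℝ => expSum c (ζ * r) := by
  have hζ0 : ζ ≠ 0 := by rintro rfl; simp at hζ
  have hcj : (c j : ℂ) ≠ 0 := by exact_mod_cast Finsupp.mem_support_iff.1 hj
  have hlim : Tendsto (fun r : ℝ => expSum c (ζ * r) / expTerm j (ζ * r)) atTop (𝓝 (c j)) := by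
    have h : Tendsto (fun r : ℝ => ∑ i ∈ c.support,
        (c i : ℂ) * (expTerm i (ζ * r) / expTerm j (ζ * r))) atTop
        (𝓝 (∑ i ∈ c.support, if i = j then (c j : ℂ) else 0)) := by
      refine tendsto_finsetSum _ fun i hi => ?_
      have hne : ∀ᶠ r : ℝ in atTop, ζ * r ≠ 0 := by
        filter_upwards [eventually_gt_atTop 0] with r hr
        exact mul_ne_zero hζ0 (by exact_mod_cast hr.ne')
      split_ifs with hij
      · subst hij
        refine tendsto_const_nhds.congr' ?_
        filter_upwards [hne] with r hr
        rw [div_self (expTerm_ne_zero _ hr), mul_one]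
      · have := (tendsto_zero_iff_norm_tendsto_zero.2
          (tendsto_norm_expTerm_ray hζ (hlead i hi hij))).const_mul (c i : ℂ)
        rw [mul_zero] at this
        refine this.congr' ?_
        filter_upwards [hne] with r hr
        rw [expTerm_div _ _ hr]
    rw [Finset.sum_ite_eq' c.support j, if_pos hj] at h
    refine h.congr fun r => ?_
    rw [expSum_eq, Finset.sum_div]
    simp only [mul_div_assoc]
  -- The quotient by the leading term tends to `c j ≠ 0`, so its norm eventually exceeds `‖c j‖ /
  -- 2`.
  refine Asymptotics.IsBigO.of_bound (‖(c j : ℂ)‖ / 2)⁻¹ ?_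
  have hpos : 0 < ‖(c j : ℂ)‖ := norm_pos_iff.2 hcj
  have := hlim.norm.eventually (lt_mem_nhds (half_lt_self hpos))
  filter_upwards [this, eventually_gt_atTop 0] with r hr hr0
  have hpos' : 0 < ‖expTerm j (ζ * r)‖ :=
    norm_pos_iff.2 (expTerm_ne_zero _ (mul_ne_zero hζ0 (by exact_mod_cast hr0.ne')))
  rw [norm_div, lt_div_iff₀ hpos'] at hr
  rw [inv_mul_eq_div, le_div_iff₀ (by positivity)]
  linarith

/-- If an exponential sum is integrable along a ray in the right half plane, then all its terms
are integrable at infinity. -/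
lemma exponents_of_integrableOn (c : ℝ × ℤ →₀ ℝ) {ζ : ℂ} (hζ : 0 < ζ.re)
    (hint : IntegrableOn (fun r : ℝ => expSum c (ζ * r)) (Set.Ioi 0)) :
    ∀ i ∈ c.support, 0 < i.1 ∨ i.1 = 0 ∧ i.2 ≤ -2 := by
  have hζ0 : ζ ≠ 0 := by rintro rfl; simp at hζ
  intro i hi
  have hc : c ≠ 0 := by rintro rfl; simp at hi
  obtain ⟨j, hj, hlead⟩ := exists_leading c hc
  have hj' : 0 < j.1 ∨ j.1 = 0 ∧ j.2 ≤ -2 := by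
    by_contra hcon
    push Not at hcon
    -- A leading term that violates the claim is at least of order `1 / r`, so the sum would
    -- dominate the non-integrable function `1 / r`.
    have h1 : (fun r : ℝ => r⁻¹) =O[atTop] fun r : ℝ => expTerm j (ζ * r) := by
      have hb : ∃ C, ∀ᶠ r : ℝ in atTop, ‖expTerm (-j.1, -1 - j.2) (ζ * r)‖ ≤ C := by
        by_cases h : 0 < -j.1 ∨ -j.1 = 0 ∧ -1 - j.2 < 0
        · exact ⟨1, (tendsto_norm_expTerm_ray hζ h).eventually (ge_mem_nhds one_pos)⟩
        -- The borderline case `j = (0, -1)`: the quotient of `1 / u` by the leading term does not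
        -- decay, but it has norm one.
        · push Not at h
          have h0 : j.1 = 0 := le_antisymm hcon.1 (by linarith [h.1])
          have h2 : j.2 = -1 := by
            have := hcon.2 h0
            have := h.2 (by simp [h0])
            omega
          refine ⟨1, Eventually.of_forall fun r => ?_⟩
          rw [norm_expTerm]
          simp [h0, h2]
      obtain ⟨C, hC⟩ := hb
      refine Asymptotics.IsBigO.of_bound (C * ‖ζ‖) ?_
      filter_upwards [hC, eventually_gt_atTop 0] with r hr hr0
      have hne : ζ * r ≠ 0 := mul_ne_zero hζ0 (by exact_mod_cast hr0.ne')
      have h3 := expTerm_div (0, -1) j hne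
      simp only [zero_sub] at h3
      rw [← h3, norm_div, div_le_iff₀ (norm_pos_iff.2 (expTerm_ne_zero _ hne))] at hr
      have h4 : ‖expTerm (0, -1) (ζ * r)‖ = ‖ζ‖⁻¹ * ‖r⁻¹‖ := by
        rw [norm_expTerm]; simp [abs_of_pos hr0, mul_comm]
      rw [h4, inv_mul_eq_div, div_le_iff₀ (norm_pos_iff.2 hζ0)] at hr
      linarith
    have h2 := h1.trans (leading_isBigO c hj hlead hζ)
    have h3 : IntegrableAtFilter (fun r : ℝ => r⁻¹) atTop := by
      refine h2.integrableAtFilter ?_ ⟨_, Ioi_mem_atTop 0, hint⟩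
      exact (measurable_inv.stronglyMeasurable).stronglyMeasurableAtFilter
    obtain ⟨s, hs, hsint⟩ := h3
    obtain ⟨a, ha⟩ := mem_atTop_sets.1 hs
    exact not_integrableOn_Ici_inv (hsint.mono_set (fun x hx => ha x hx) : IntegrableOn _ (Set.Ici a))
  by_cases hij : i = j
  · exact hij ▸ hj'
  · rcases hlead i hi hij with h | ⟨h, h'⟩
    · rcases hj' with h2 | ⟨h2, _⟩
      · exact Or.inl (by linarith)
      · exact Or.inl (by linarith)
    · rcases hj' with h2 | ⟨h2, h3⟩
      · exact Or.inl (by linarith)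
      · exact Or.inr ⟨by linarith, by omega⟩

/-- If an exponential sum is integrable along a ray, then it is bounded at the origin. -/
lemma exists_tendsto_of_integrableOn (c : ℝ × ℤ →₀ ℝ) {ζ : ℂ} (hζ0 : ζ ≠ 0)
    (hint : IntegrableOn (fun r : ℝ => expSum c (ζ * r)) (Set.Ioi 0)) :
    ∃ l, Tendsto (expSum c) (𝓝[≠] 0) (𝓝 l) := by
  have hmero := meromorphicAt_expSum c
  rw [tendsto_nhds_iff_meromorphicOrderAt_nonneg hmero]
  by_contra hneg
  push Not at hneg
  obtain ⟨n, hn⟩ := WithTop.ne_top_iff_exists.1 hneg.ne_top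
  rw [← hn] at hneg
  have hn0 : n < 0 := by exact_mod_cast hneg
  obtain ⟨g, hg, hg0, hfg⟩ := (meromorphicOrderAt_eq_int_iff hmero).1 hn.symm
  have hray : Tendsto (fun r : ℝ => ζ * r) (𝓝[>] 0) (𝓝[≠] 0) := by
    refine tendsto_nhdsWithin_iff.2 ⟨?_, ?_⟩
    · have : Continuous fun r : ℝ => ζ * r := by fun_prop
      simpa using (this.tendsto 0).mono_left nhdsWithin_le_nhds
    · filter_upwards [self_mem_nhdsWithin] with r hr
      exact mul_ne_zero hζ0 (by exact_mod_cast (ne_of_gt hr))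
  have hgpos : 0 < ‖g 0‖ := norm_pos_iff.2 hg0
  have h1 : ∀ᶠ u in 𝓝[≠] (0 : ℂ), ‖g 0‖ / 2 < ‖g u‖ :=
    (hg.continuousAt.norm.tendsto.mono_left nhdsWithin_le_nhds).eventually
      (lt_mem_nhds (half_lt_self hgpos))
  have hsmall : ∀ᶠ r : ℝ in 𝓝[>] 0, ‖ζ * r‖ < 1 := by
    have : Tendsto (fun r : ℝ => ‖ζ * r‖) (𝓝[>] 0) (𝓝 0) := by
      simpa using (hray.mono_right nhdsWithin_le_nhds).norm
    exact this.eventually (gt_mem_nhds one_pos)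
  -- Single terms may be singular at the origin and cancel in the sum, so the argument uses the
  -- meromorphic order of the whole sum. A negative order `n` gives `‖u‖ ^ n ≥ ‖u‖⁻¹` for `‖u‖ < 1`,
  -- again contradicting integrability.
  have hO : (fun r : ℝ => r⁻¹) =O[𝓝[>] 0] fun r : ℝ => expSum c (ζ * r) := by
    refine Asymptotics.IsBigO.of_bound (‖ζ‖ * (‖g 0‖ / 2)⁻¹) ?_
    filter_upwards [hray.eventually h1, hray.eventually hfg, hsmall, self_mem_nhdsWithin]
      with r h1 h2 h3 (h4 : 0 < r)
    have hpos : 0 < ‖ζ * r‖ := norm_pos_iff.2 (mul_ne_zero hζ0 (by exact_mod_cast h4.ne'))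
    rw [h2]
    simp only [sub_zero, smul_eq_mul]
    rw [norm_mul _ (g _), norm_zpow]
    have h5 : ‖ζ * r‖⁻¹ ≤ ‖ζ * r‖ ^ n := by
      rw [← zpow_neg_one]
      exact zpow_le_zpow_right_of_le_one₀ hpos h3.le (by omega)
    have h6 : ‖r⁻¹‖ = ‖ζ‖ * ‖ζ * r‖⁻¹ := by
      have := norm_pos_iff.2 hζ0
      rw [norm_mul, Complex.norm_real, norm_inv]
      field_simp
    rw [h6, mul_assoc]
    gcongr
    rw [inv_mul_eq_div, le_div_iff₀ (by positivity)]
    gcongr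
  have h3 : IntegrableAtFilter (fun r : ℝ => r⁻¹) (𝓝[>] 0) := by
    refine hO.integrableAtFilter ?_ ⟨_, self_mem_nhdsWithin, hint⟩
    exact (measurable_inv.stronglyMeasurable).stronglyMeasurableAtFilter
  obtain ⟨s, hs, hsint⟩ := h3
  obtain ⟨a, ha, hsub⟩ := mem_nhdsGT_iff_exists_Ioc_subset.1 hs
  have : IntervalIntegrable (fun r : ℝ => r⁻¹) volume 0 a :=
    (intervalIntegrable_iff_integrableOn_Ioc_of_le (le_of_lt ha)).2 (hsint.mono_set hsub)
  rw [intervalIntegrable_inv_iff] at this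
  rcases this with h | h
  · exact (ne_of_lt ha) h
  · exact h Set.left_mem_uIcc

/-- An exponential sum in the logarithmic coordinate, times the Jacobian. -/
def logSum (c : ℝ × ℤ →₀ ℝ) (t : ℂ) : ℂ := expSum c (Complex.exp t) * Complex.exp t

lemma differentiable_logSum (c : ℝ × ℤ →₀ ℝ) : Differentiable ℂ (logSum c) := fun t =>
  ((differentiableAt_expSum c (Complex.exp_ne_zero t)).comp t
    Complex.differentiableAt_exp).mul Complex.differentiableAt_exp

lemma logSum_ofReal_im (c : ℝ × ℤ →₀ ℝ) (x : ℝ) : (logSum c x).im = 0 := by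
  rw [logSum, ← Complex.ofReal_exp, Complex.im_mul_ofReal, expSum_ofReal_im, zero_mul]

lemma cos_le_cos_of_mem_uIcc {φ y : ℝ} (hφ : |φ| < Real.pi / 2) (hy : y ∈ Set.uIcc 0 φ) :
    Real.cos φ ≤ Real.cos y := by
  rw [← Real.cos_abs φ, ← Real.cos_abs y]
  have : |y| ≤ |φ| := by
    simpa using Set.abs_sub_left_of_mem_uIcc hy
  exact Real.cos_le_cos_of_nonneg_of_le_pi (abs_nonneg _) (by linarith [Real.pi_pos]) this

/-- The decay rate `a e^x cos y` is smallest at the edge `y = φ` of the strip. The Jacobian raises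
each power by one, so terms with `a = 0` decay precisely because `p ≤ -2`. -/
lemma logSum_bound_atTop (c : ℝ × ℤ →₀ ℝ)
    (hc : ∀ i ∈ c.support, 0 < i.1 ∨ i.1 = 0 ∧ i.2 ≤ -2) {φ : ℝ} (hφ : |φ| < Real.pi / 2) :
    ∃ M : ℝ → ℝ, Tendsto M atTop (𝓝 0) ∧
      ∀ x : ℝ, ∀ y ∈ Set.uIcc 0 φ, ‖logSum c (x + y * Complex.I)‖ ≤ M x := by
  have hcos : 0 < Real.cos φ := Real.cos_pos_of_mem_Ioo (abs_lt.1 hφ)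
  refine ⟨fun x => ∑ i ∈ c.support, |c i| * (Real.exp x ^ (i.2 + 1) *
    Real.exp (-(i.1 * Real.cos φ * Real.exp x))), ?_, fun x y hy => ?_⟩
  · rw [← Finset.sum_const_zero (s := c.support)]
    refine tendsto_finsetSum _ fun i hi => ?_
    have h : 0 < i.1 * Real.cos φ ∨ i.1 * Real.cos φ = 0 ∧ i.2 + 1 < 0 := by
      rcases hc i hi with h | ⟨h, h'⟩
      · exact Or.inl (by positivity)
      · exact Or.inr ⟨by simp [h], by omega⟩
    simpa using ((tendsto_zpow_mul_exp_atTop h).comp Real.tendsto_exp_atTop).const_mul |c i|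
  · rw [logSum, expSum_eq, Finset.sum_mul]
    refine (norm_sum_le _ _).trans (Finset.sum_le_sum fun i hi => ?_)
    rw [norm_mul, norm_mul, norm_expTerm, Complex.norm_real, Real.norm_eq_abs, Complex.norm_exp,
      mul_assoc, Complex.exp_re]
    have h0 : 0 ≤ i.1 := by rcases hc i hi with h | h <;> [exact h.le; exact h.1.ge]
    have h1 := cos_le_cos_of_mem_uIcc hφ hy
    simp only [Complex.add_re, Complex.ofReal_re, Complex.mul_re, Complex.I_re, mul_zero,
      Complex.ofReal_im, Complex.I_im, mul_one, sub_self, add_zero, Complex.add_im,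
      Complex.mul_im]
    rw [zpow_add_one₀ (Real.exp_ne_zero x), zero_add, mul_assoc (Real.exp x ^ i.2),
      mul_assoc (Real.exp x ^ i.2), mul_comm (Real.exp x) (Real.exp _), mul_assoc i.1,
      mul_comm (Real.cos φ)]
    gcongr

/-- The limit at the origin is taken over all directions, so the sum is bounded uniformly in `y`,
and the Jacobian supplies the decay `e^x`. -/
lemma logSum_bound_atBot (c : ℝ × ℤ →₀ ℝ) {l : ℂ} (hl : Tendsto (expSum c) (𝓝[≠] 0) (𝓝 l)) :
    ∃ M : ℝ → ℝ, Tendsto M atBot (𝓝 0) ∧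
      ∀ᶠ x : ℝ in atBot, ∀ y : ℝ, ‖logSum c (x + y * Complex.I)‖ ≤ M x := by
  refine ⟨fun x => (‖l‖ + 1) * Real.exp x, ?_, ?_⟩
  · simpa using Real.tendsto_exp_atBot.const_mul (‖l‖ + 1)
  · have h1 : ∀ᶠ u in 𝓝[≠] (0 : ℂ), ‖expSum c u‖ ≤ ‖l‖ + 1 :=
      hl.norm.eventually (ge_mem_nhds (lt_add_one _))
    rw [eventually_nhdsWithin_iff, Metric.eventually_nhds_iff] at h1
    obtain ⟨δ, hδ, h1⟩ := h1
    filter_upwards [Real.tendsto_exp_atBot.eventually (gt_mem_nhds hδ)] with x hx y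
    have hn : ‖Complex.exp (x + y * Complex.I)‖ = Real.exp x := by simp [Complex.norm_exp]
    rw [logSum, norm_mul, hn]
    gcongr
    exact h1 (by rw [dist_zero_right, hn]; exact hx) (Complex.exp_ne_zero _)

/-- The integral of an exponential sum over a horizontal line in the logarithmic coordinate is
asymptotically real. -/
lemma tendsto_integral_logSum_im (c : ℝ × ℤ →₀ ℝ)
    (hc : ∀ i ∈ c.support, 0 < i.1 ∨ i.1 = 0 ∧ i.2 ≤ -2)
    {l : ℂ} (hl : Tendsto (expSum c) (𝓝[≠] 0) (𝓝 l)) {φ : ℝ} (hφ : |φ| < Real.pi / 2) (a : ℝ) :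
    Tendsto (fun X : ℝ => (∫ x in (-X + a)..(X + a), logSum c (x + φ * Complex.I)).im)
      atTop (𝓝 0) := by
  obtain ⟨M, hM, hMb⟩ := logSum_bound_atTop c hc hφ
  obtain ⟨N, hN, hNb⟩ := logSum_bound_atBot c hl
  have hXtop : Tendsto (fun X : ℝ => X + a) atTop atTop := tendsto_atTop_add_const_right _ _ tendsto_id
  have hXbot : Tendsto (fun X : ℝ => -X + a) atTop atBot :=
    tendsto_atBot_add_const_right _ _ tendsto_neg_atTop_atBot
  have hlim : Tendsto (fun X : ℝ => M (X + a) * |φ| + N (-X + a) * |φ|) atTop (𝓝 0) := by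
    simpa using ((hM.comp hXtop).mul_const |φ|).add ((hN.comp hXbot).mul_const |φ|)
  refine squeeze_zero_norm' ?_ hlim
  filter_upwards [hXbot.eventually hNb] with X hX
  -- The lower side of the rectangle lies on the real axis, where `logSum` is real. The upper side
  -- is the truncated ray, and the vertical sides are the arcs to be discarded.
  have hrect := Complex.integral_boundary_rect_eq_zero_of_differentiableOn (logSum c)
    ((-X + a : ℝ) : ℂ) ((X + a : ℝ) + φ * Complex.I) (differentiable_logSum c).differentiableOn
  simp only [Complex.add_re, Complex.ofReal_re, Complex.mul_re, Complex.I_re, mul_zero,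
    Complex.ofReal_im, Complex.I_im, mul_one, sub_self, add_zero, Complex.add_im,
    Complex.mul_im, zero_add, Complex.ofReal_zero, zero_mul, smul_eq_mul] at hrect
  have hreal : (∫ x in (-X + a)..(X + a), logSum c x).im = 0 := by
    have : (fun x : ℝ => logSum c x) = fun x : ℝ => (((logSum c x).re : ℝ) : ℂ) := by
      funext x
      exact Complex.ext rfl (by simp [logSum_ofReal_im])
    rw [this, intervalIntegral.integral_ofReal, Complex.ofReal_im]
  have hb1 : ‖∫ y in (0 : ℝ)..φ, logSum c ((X + a : ℝ) + y * Complex.I)‖ ≤ M (X + a) * |φ| := by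
    simpa using intervalIntegral.norm_integral_le_of_norm_le_const
      (fun y hy => hMb (X + a) y (Set.uIoc_subset_uIcc hy))
  have hb2 : ‖∫ y in (0 : ℝ)..φ, logSum c ((-X + a : ℝ) + y * Complex.I)‖ ≤ N (-X + a) * |φ| := by
    simpa using intervalIntegral.norm_integral_le_of_norm_le_const (a := 0) (b := φ)
      (fun y _ => hX y)
  have him := congrArg Complex.im hrect
  simp only [Complex.sub_im, Complex.add_im, hreal, Complex.I_mul_im, Complex.zero_im] at him
  have h1 := (Complex.abs_re_le_norm _).trans hb1
  have h2 := (Complex.abs_re_le_norm _).trans hb2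
  rw [Real.norm_eq_abs]
  refine le_trans ?_ (add_le_add h1 h2)
  have : (∫ x in (-X + a)..(X + a), logSum c (x + φ * Complex.I)).im =
      (∫ y in (0 : ℝ)..φ, logSum c ((X + a : ℝ) + y * Complex.I)).re -
      (∫ y in (0 : ℝ)..φ, logSum c ((-X + a : ℝ) + y * Complex.I)).re := by linarith
  rw [this]
  exact abs_sub _ _

/-- If a real exponential sum is integrable along a ray in the right half plane, then its integral
over the ray is real: the ray can be rotated to the positive real axis. -/
theorem ray_integral_im (c : ℝ × ℤ →₀ ℝ) {ζ : ℂ} (hζ : 0 < ζ.re)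
    (hint : IntegrableOn (fun r : ℝ => expSum c (ζ * r)) (Set.Ioi 0)) :
    (ζ * ∫ r in Set.Ioi (0 : ℝ), expSum c (ζ * r)).im = 0 := by
  have hζ0 : ζ ≠ 0 := by rintro rfl; simp at hζ
  obtain ⟨l, hl⟩ := exists_tendsto_of_integrableOn c hζ0 hint
  have hφ : |ζ.arg| < Real.pi / 2 := Complex.abs_arg_lt_pi_div_two_iff.2 (Or.inl hζ)
  have h1 := tendsto_integral_logSum_im c (exponents_of_integrableOn c hζ hint) hl hφ
    (Real.log ‖ζ‖)
  -- Cutting off at `e^{-X}` and `e^X` makes the substitution `r = e^x` produce the interval `[-X,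
  -- X]`. The modulus of `ζ` then shifts it by `log ‖ζ‖`, and its argument is the height of the
  -- line.
  have hcov : AECover (volume.restrict (Set.Ioi (0 : ℝ))) atTop
      (fun X : ℝ => Set.Ioc (Real.exp (-X)) (Real.exp X)) := by
    refine ⟨?_, fun _ => measurableSet_Ioc⟩
    filter_upwards [ae_restrict_mem measurableSet_Ioi] with r (hr : 0 < r)
    have h2 : Tendsto (fun X : ℝ => Real.exp (-X)) atTop (𝓝 0) := Real.tendsto_exp_atBot.comp tendsto_neg_atTop_atBot
    filter_upwards [h2.eventually (gt_mem_nhds hr), Real.tendsto_exp_atTop.eventually_ge_atTop r]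
      with X ha hb using ⟨ha, hb⟩
  have h2 := hcov.integral_tendsto_of_countably_generated hint
  have h3 := (Complex.continuous_im.tendsto _).comp (h2.const_mul ζ)
  refine tendsto_nhds_unique h3 (h1.congr' ?_)
  filter_upwards [eventually_ge_atTop 0] with X hX
  simp only [Function.comp]
  congr 1
  have hle : Real.exp (-X) ≤ Real.exp X := Real.exp_le_exp.2 (by linarith)
  have hset : Set.Ioc (Real.exp (-X)) (Real.exp X) ∩ Set.Ioi 0 =
      Set.Ioc (Real.exp (-X)) (Real.exp X) :=
    Set.inter_eq_left.2 fun r hr => (Real.exp_pos _).trans hr.1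
  rw [Measure.restrict_restrict measurableSet_Ioc, hset, ← intervalIntegral.integral_of_le hle,
    ← intervalIntegral.integral_comp_add_right (fun x : ℝ => logSum c (x + ζ.arg * Complex.I)),
    ← intervalIntegral.integral_const_mul]
  have hsub := intervalIntegral.integral_deriv_smul_comp''' (a := -X) (b := X) (f := Real.exp)
    (f' := Real.exp) (g := fun r : ℝ => ζ * expSum c (ζ * r)) Real.continuous_exp.continuousOn
    (fun x _ => (Real.hasDerivAt_exp x).hasDerivWithinAt) ?_ ?_ ?_
  · rw [← hsub]
    refine intervalIntegral.integral_congr fun x _ => ?_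
    have hexp : Complex.exp ((x + Real.log ‖ζ‖ : ℝ) + ζ.arg * Complex.I) = ζ * Real.exp x := by
      have : ((x + Real.log ‖ζ‖ : ℝ) : ℂ) + ζ.arg * Complex.I = x + Complex.log ζ := by
        rw [Complex.log]; push_cast; ring
      rw [this, Complex.exp_add, Complex.exp_log hζ0, Complex.ofReal_exp, mul_comm]
    simp only [logSum, hexp, Function.comp, Complex.real_smul]
    ring
  all_goals
    have hc : ContinuousOn (fun r : ℝ => ζ * expSum c (ζ * r)) (Set.Ioi 0) := by
      intro r (hr : 0 < r)
      have : ζ * (r : ℂ) ≠ 0 := mul_ne_zero hζ0 (by exact_mod_cast hr.ne')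
      have h := (differentiableAt_expSum c this).continuousAt
      have h4 : ContinuousAt (fun r : ℝ => ζ * (r : ℂ)) r := by fun_prop
      exact (continuousAt_const.mul (ContinuousAt.comp (f := fun r : ℝ => ζ * (r : ℂ)) h h4)).continuousWithinAt
  · refine hc.mono ?_
    rintro _ ⟨x, -, rfl⟩
    exact Real.exp_pos x
  · refine (hc.mono ?_).integrableOn_compact (isCompact_uIcc.image Real.continuous_exp)
    rintro _ ⟨x, -, rfl⟩
    exact Real.exp_pos x
  · refine ContinuousOn.integrableOn_compact isCompact_uIcc
      (Real.continuous_exp.continuousOn.smul (hc.comp Real.continuous_exp.continuousOn ?_))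
    intro x _
    exact Real.exp_pos x

/-! ### Jets of smooth fields -/

lemma partialDeriv_contDiff {f : ℝ × Space → ℝ} (hf : ContDiff ℝ ∞ f) (v : ℝ × Space) :
    ContDiff ℝ ∞ (partialDeriv v f) :=
  (hf.fderiv_right (m := ∞) (by simp)).clm_apply contDiff_const

lemma partialDeriv_iterate_contDiff {f : ℝ × Space → ℝ} (hf : ContDiff ℝ ∞ f) (v : ℝ × Space)
    (n : ℕ) : ContDiff ℝ ∞ ((partialDeriv v)^[n] f) := by
  induction n with
  | zero => exact hf
  | succ n ih =>
    rw [Function.iterate_succ_apply']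
    exact partialDeriv_contDiff ih v

lemma partialDeriv_iterate_add {f g : ℝ × Space → ℝ} (hf : ContDiff ℝ ∞ f) (hg : ContDiff ℝ ∞ g)
    (v : ℝ × Space) (n : ℕ) :
    (partialDeriv v)^[n] (f + g) = (partialDeriv v)^[n] f + (partialDeriv v)^[n] g := by
  induction n with
  | zero => rfl
  | succ n ih =>
    simp only [Function.iterate_succ_apply', ih]
    funext p
    have h1 := (partialDeriv_iterate_contDiff hf v n).differentiable (by simp) p
    have h2 := (partialDeriv_iterate_contDiff hg v n).differentiable (by simp) p
    simp [partialDeriv, fderiv_add h1 h2]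

lemma partialDeriv_iterate_zero (v : ℝ × Space) (n : ℕ) : (partialDeriv v)^[n] 0 = 0 := by
  induction n with
  | zero => rfl
  | succ n ih =>
    rw [Function.iterate_succ_apply', ih]
    funext p
    simp [partialDeriv]

lemma partialDeriv_iterate_comp_smul (f : ℝ × Space → ℝ) (v : ℝ × Space) (a l : ℝ) (n : ℕ) :
    (partialDeriv v)^[n] (fun q => a * f (l • q)) =
      fun q => l ^ n * a * (partialDeriv v)^[n] f (l • q) := by
  induction n with
  | zero => simp
  | succ n ih =>
    simp only [Function.iterate_succ_apply', ih]
    funext p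
    have h : (fun q => l ^ n * a * (partialDeriv v)^[n] f (l • q)) =
        (l ^ n * a) • fun q => (partialDeriv v)^[n] f (l • q) := rfl
    rw [partialDeriv, h, fderiv_const_smul_field, Pi.smul_apply, fderiv_comp_smul]
    simp only [smul_apply, smul_eq_mul, partialDeriv]
    ring

/-- The total number of derivatives of a jet variable. -/
def jetOrder {ι : Type*} (J : Jet ι) : ℕ := J.2.1 + (J.2.2 0 + (J.2.2 1 + J.2.2 2))

lemma jetValue_comp_smul {ι : Type*} (φ : ι → ℝ × Space → ℝ) (J : Jet ι) (l : ℝ) (p : ℝ × Space) :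
    jetValue (fun f q => φ f (l • q)) J p = l ^ jetOrder J * jetValue φ J (l • p) := by
  have h : (fun q => φ J.1 (l • q)) = fun q => 1 * φ J.1 (l • q) := by simp
  simp only [jetValue, h, partialDeriv_iterate_comp_smul, jetOrder, pow_add, mul_one]

/-- The monomials in the displacement from the spacetime point `p`. -/
def displacementMonomial (p : ℝ × Space) (n a b c : ℕ) (q : ℝ × Space) : ℝ :=
  (q.1 - p.1) ^ n * ((q.2 0 - p.2 0) ^ a * ((q.2 1 - p.2 1) ^ b * (q.2 2 - p.2 2) ^ c))

lemma contDiff_displacementMonomial (p : ℝ × Space) (n a b c : ℕ) :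
    ContDiff ℝ ∞ (displacementMonomial p n a b c) := by
  unfold displacementMonomial
  fun_prop

lemma partialDeriv_eq_of_hasDerivAt {f : ℝ × Space → ℝ} (hf : ContDiff ℝ ∞ f) {v q : ℝ × Space}
    {d : ℝ} (h : HasDerivAt (fun t : ℝ => f (q + t • v)) d 0) : partialDeriv v f q = d := by
  rw [partialDeriv, ← (hf.differentiable (by simp) q).lineDeriv_eq_fderiv]
  exact h.deriv

lemma hasDerivAt_shift_pow (x : ℝ) (n : ℕ) :
    HasDerivAt (fun t : ℝ => (x + t) ^ n) (n * x ^ (n - 1)) 0 := by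
  simpa using ((hasDerivAt_id (0 : ℝ)).const_add x).fun_pow n

lemma partialDeriv_timeDir_monomial (p : ℝ × Space) (B : ℝ) (n a b c : ℕ) :
    partialDeriv timeDir (fun q => B * displacementMonomial p n a b c q) =
      fun q => B * n * displacementMonomial p (n - 1) a b c q := by
  funext q
  refine partialDeriv_eq_of_hasDerivAt
    (contDiff_const.mul (contDiff_displacementMonomial p n a b c)) ?_
  have := ((hasDerivAt_shift_pow (q.1 - p.1) n).mul_const
    ((q.2 0 - p.2 0) ^ a * ((q.2 1 - p.2 1) ^ b * (q.2 2 - p.2 2) ^ c))).const_mul B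
  refine (this.congr_deriv ?_).congr_of_eventuallyEq (Eventually.of_forall fun t => ?_)
  · simp only [displacementMonomial]; ring
  · simp [displacementMonomial, timeDir]; left; left; ring

lemma partialDeriv_spaceDir_zero_monomial (p : ℝ × Space) (B : ℝ) (n a b c : ℕ) :
    partialDeriv (spaceDir 0) (fun q => B * displacementMonomial p n a b c q) =
      fun q => B * a * displacementMonomial p n (a - 1) b c q := by
  funext q
  refine partialDeriv_eq_of_hasDerivAt
    (contDiff_const.mul (contDiff_displacementMonomial p n a b c)) ?_
  have := ((hasDerivAt_shift_pow (q.2 0 - p.2 0) a).mul_const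
    ((q.1 - p.1) ^ n * ((q.2 1 - p.2 1) ^ b * (q.2 2 - p.2 2) ^ c))).const_mul B
  refine (this.congr_deriv ?_).congr_of_eventuallyEq (Eventually.of_forall fun t => ?_)
  · simp only [displacementMonomial]; ring
  · simp [displacementMonomial, spaceDir]; left; ring

lemma partialDeriv_spaceDir_one_monomial (p : ℝ × Space) (B : ℝ) (n a b c : ℕ) :
    partialDeriv (spaceDir 1) (fun q => B * displacementMonomial p n a b c q) =
      fun q => B * b * displacementMonomial p n a (b - 1) c q := by
  funext q
  refine partialDeriv_eq_of_hasDerivAt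
    (contDiff_const.mul (contDiff_displacementMonomial p n a b c)) ?_
  have := ((hasDerivAt_shift_pow (q.2 1 - p.2 1) b).mul_const
    ((q.1 - p.1) ^ n * ((q.2 0 - p.2 0) ^ a * (q.2 2 - p.2 2) ^ c))).const_mul B
  refine (this.congr_deriv ?_).congr_of_eventuallyEq (Eventually.of_forall fun t => ?_)
  · simp only [displacementMonomial]; ring
  · simp [displacementMonomial, spaceDir]; left; ring

lemma partialDeriv_spaceDir_two_monomial (p : ℝ × Space) (B : ℝ) (n a b c : ℕ) :
    partialDeriv (spaceDir 2) (fun q => B * displacementMonomial p n a b c q) =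
      fun q => B * c * displacementMonomial p n a b (c - 1) q := by
  funext q
  refine partialDeriv_eq_of_hasDerivAt
    (contDiff_const.mul (contDiff_displacementMonomial p n a b c)) ?_
  have := ((hasDerivAt_shift_pow (q.2 2 - p.2 2) c).mul_const
    ((q.1 - p.1) ^ n * ((q.2 0 - p.2 0) ^ a * (q.2 1 - p.2 1) ^ b))).const_mul B
  refine (this.congr_deriv ?_).congr_of_eventuallyEq (Eventually.of_forall fun t => ?_)
  · simp only [displacementMonomial]; ring
  · simp [displacementMonomial, spaceDir]; left; ring

/-- Iterating an operator that lowers one exponent of a family of functions. -/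
lemma iterate_lowering (T : (ℝ × Space → ℝ) → ℝ × Space → ℝ) (M : ℕ → ℝ × Space → ℝ)
    (h : ∀ B n, T (fun q => B * M n q) = fun q => B * n * M (n - 1) q) (B : ℝ) (n k : ℕ) :
    T^[k] (fun q => B * M n q) = fun q => B * n.descFactorial k * M (n - k) q := by
  induction k with
  | zero => simp
  | succ k ih =>
    rw [Function.iterate_succ_apply', ih, h, Nat.descFactorial_succ]
    funext q
    push_cast
    rw [Nat.sub_sub]
    ring

/-- This evaluates a differentiated monomial at its base point. For `n < k` truncated subtraction
makes the power of zero equal to one, and the vanishing comes from the descending factorial. -/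
lemma descFactorial_mul_zero_pow (n k : ℕ) :
    (n.descFactorial k : ℝ) * 0 ^ (n - k) = if n = k then (n.factorial : ℝ) else 0 := by
  split_ifs with h
  · subst h; simp [Nat.descFactorial_self]
  · rcases lt_or_gt_of_ne h with h | h
    · simp [Nat.descFactorial_eq_zero_iff_lt.2 h]
    · rw [zero_pow (by omega), mul_zero]

/-- Every finite jet at a point is the jet of a smooth field. -/
lemma exists_jet {ι : Type*} (p : ℝ × Space) (x : Jet ι →₀ ℝ) :
    ∃ φ : ι → ℝ × Space → ℝ, (∀ f, ContDiff ℝ ∞ (φ f)) ∧ ∀ J, jetValue φ J p = x J := by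
  classical
  induction x using Finsupp.induction_linear with
  | zero =>
    exact ⟨fun _ => 0, fun _ => contDiff_const, fun J => by
      simp [jetValue, partialDeriv_iterate_zero]⟩
  | add x y hx hy =>
    obtain ⟨φ, hφ, hφx⟩ := hx
    obtain ⟨χ, hχ, hχy⟩ := hy
    refine ⟨fun f => φ f + χ f, fun f => (hφ f).add (hχ f), fun J => ?_⟩
    rw [Finsupp.add_apply, ← hφx, ← hχy]
    have hd := @partialDeriv_iterate_contDiff
    simp only [jetValue]
    rw [partialDeriv_iterate_add (hφ _) (hχ _),
      partialDeriv_iterate_add (hd (hφ _) _ _) (hd (hχ _) _ _),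
      partialDeriv_iterate_add (hd (hd (hφ _) _ _) _ _) (hd (hd (hχ _) _ _) _ _),
      partialDeriv_iterate_add (hd (hd (hd (hφ _) _ _) _ _) _ _)
        (hd (hd (hd (hχ _) _ _) _ _) _ _), Pi.add_apply]
  | single J₀ B =>
    obtain ⟨f₀, n₀, α₀⟩ := J₀
    -- These factorials remain when every exponent is differentiated down to zero; dividing by them
    -- normalizes the selected jet value to `B`.
    let N : ℝ := n₀.factorial * ((α₀ 0).factorial * ((α₀ 1).factorial * (α₀ 2).factorial))
    have hN : N ≠ 0 := by
      have := Nat.factorial_ne_zero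
      simp [N, this]
    refine ⟨fun f => if f = f₀ then fun q =>
      B / N * displacementMonomial p n₀ (α₀ 0) (α₀ 1) (α₀ 2) q else 0, fun f => ?_, ?_⟩
    · dsimp only
      split_ifs
      · exact contDiff_const.mul (contDiff_displacementMonomial _ _ _ _ _)
      · exact contDiff_const
    · rintro ⟨f, n, α⟩
      simp only [jetValue]
      by_cases hf : f = f₀
      · subst hf
        rw [if_pos rfl,
          iterate_lowering _ (fun c => displacementMonomial p n₀ (α₀ 0) (α₀ 1) c)
            (fun B c => partialDeriv_spaceDir_two_monomial p B _ _ _ c),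
          iterate_lowering _ (fun b => displacementMonomial p n₀ (α₀ 0) b _)
            (fun B b => partialDeriv_spaceDir_one_monomial p B _ _ b _),
          iterate_lowering _ (fun a => displacementMonomial p n₀ a _ _)
            (fun B a => partialDeriv_spaceDir_zero_monomial p B _ a _ _),
          iterate_lowering _ (fun n => displacementMonomial p n _ _ _)
            (fun B n => partialDeriv_timeDir_monomial p B n _ _ _)]
        have key : ∀ A x0 x1 x2 x3 y0 y1 y2 y3 : ℝ,
            A * x3 * x2 * x1 * x0 * (y0 * (y1 * (y2 * y3))) =
            A * ((x0 * y0) * ((x1 * y1) * ((x2 * y2) * (x3 * y3)))) := by intros; ring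
        simp only [displacementMonomial, sub_self]
        rw [key]
        simp only [descFactorial_mul_zero_pow]
        by_cases hJ : n₀ = n ∧ α₀ = α
        · obtain ⟨rfl, rfl⟩ := hJ
          simp only [if_true, Finsupp.single_eq_same]
          exact div_mul_cancel₀ B hN
        · rw [Finsupp.single_eq_of_ne (by simpa [eq_comm] using hJ)]
          by_cases hn : n₀ = n
          · have hα : ¬(α₀ 0 = α 0 ∧ α₀ 1 = α 1 ∧ α₀ 2 = α 2) := by
              rintro ⟨h0, h1, h2⟩
              refine hJ ⟨hn, funext fun i => ?_⟩
              fin_cases i <;> assumption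
            by_cases h0 : α₀ 0 = α 0
            · by_cases h1 : α₀ 1 = α 1
              · have h2 : ¬ α₀ 2 = α 2 := fun h2 => hα ⟨h0, h1, h2⟩
                simp [h2]
              · simp [h1]
            · simp [h0]
          · simp [hn]
      · rw [if_neg hf, Finsupp.single_eq_of_ne (by simp [hf])]
        simp [partialDeriv_iterate_zero]

/-! ### Scaling of the couplings -/

/-- The total number of derivatives in a monomial of jet variables. -/
def derivCount {ι : Type*} : (Jet ι →₀ ℕ) →+ ℕ := Finsupp.weight jetOrder

lemma density_eq {ι : Type*} (O : LocalInteraction ι) (φ : ι → ℝ × Space → ℝ) (p : ℝ × Space) :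
    O.density φ p = ∑ m ∈ O.lag.support,
      O.lag.coeff m (p.1 : ℂ) * ∏ J ∈ m.support, (jetValue φ J p : ℂ) ^ m J := by
  rw [LocalInteraction.density, MvPolynomial.eval₂_eq]
  rfl

/-- Jets of smooth fields at a point take arbitrary real values on any finite set of jet variables.
Invariance of the density is therefore an identity between polynomials at all real points, and
coefficients can be compared. A monomial acquires one factor `l` per derivative. -/
lemma coeff_scaling {ι : Type*} (O : LocalInteraction ι) (hO : O.DilationInvariant)
    {l τ : ℝ} (hl : 0 < l) (hτ : τ < 0) (m : Jet ι →₀ ℕ) :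
    O.lag.coeff m (τ : ℂ) * (l : ℂ) ^ derivCount m =
      (l : ℂ) ^ 4 * O.lag.coeff m ((l * τ : ℝ) : ℂ) := by
  classical
  let P : MvPolynomial (Jet ι) ℂ := ∑ m ∈ O.lag.support, MvPolynomial.monomial m
    (O.lag.coeff m (τ : ℂ) * (l : ℂ) ^ derivCount m -
      (l : ℂ) ^ 4 * O.lag.coeff m ((l * τ : ℝ) : ℂ))
  have hP : P = 0 := by
    refine MvPolynomial.funext_set (fun _ : Jet ι => Set.range ((↑) : ℝ → ℂ))
      (fun _ => ?_) fun x hx => ?_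
    · exact Set.infinite_range_of_injective Complex.ofReal_injective
    · choose y hy using fun J => hx J (Set.mem_univ J)
      let S : Finset (Jet ι) := O.lag.support.biUnion fun m => m.support
      let z : Jet ι →₀ ℝ := Finsupp.onFinset S (fun J => if J ∈ S then y J else 0)
        (fun J hJ => by by_contra h; simp [h] at hJ)
      have hz : ∀ J ∈ S, (z J : ℂ) = x J := fun J hJ => by simp [z, hJ, hy]
      -- The jet is prescribed at the image point `l • (τ, 0)`, since there the chain rule evaluates
      -- the derivatives of the rescaled field.
      obtain ⟨φ, hφ, hφz⟩ := exists_jet (l • ((τ, 0) : ℝ × Space)) z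
      have h := hO l hl φ hφ (τ, 0) hτ
      rw [density_eq, density_eq] at h
      simp only [jetValue_comp_smul, hφz] at h
      rw [map_sum, map_zero]
      simp only [MvPolynomial.eval_monomial, sub_mul, Finset.sum_sub_distrib]
      rw [sub_eq_zero]
      rw [Finset.mul_sum] at h
      convert h using 1
      · refine Finset.sum_congr rfl fun m hm => ?_
        rw [mul_assoc]
        congr 1
        have : (l : ℂ) ^ derivCount m = ∏ J ∈ m.support, ((l : ℂ) ^ jetOrder J) ^ m J := by
          rw [derivCount, Finsupp.weight_apply, Finsupp.sum, ← Finset.prod_pow_eq_pow_sum]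
          refine Finset.prod_congr rfl fun J _ => ?_
          rw [← pow_mul, smul_eq_mul, mul_comm]
        rw [this, Finsupp.prod, ← Finset.prod_mul_distrib]
        refine Finset.prod_congr rfl fun J hJ => ?_
        rw [← hz J (Finset.mem_biUnion.2 ⟨m, hm, hJ⟩)]
        push_cast
        rw [mul_pow]
      · refine Finset.sum_congr rfl fun m hm => ?_
        rw [mul_assoc]
        congr 2
        refine Finset.prod_congr rfl fun J hJ => ?_
        dsimp only
        rw [← hz J (Finset.mem_biUnion.2 ⟨m, hm, hJ⟩)]
  by_cases hm : m ∈ O.lag.support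
  · have h := congrArg (MvPolynomial.coeff m) hP
    simp only [P, MvPolynomial.coeff_sum, MvPolynomial.coeff_monomial, MvPolynomial.coeff_zero,
      Finset.sum_ite_eq', if_pos hm] at h
    exact sub_eq_zero.1 h
  · simp [MvPolynomial.notMem_support_iff.1 hm]

/-- The couplings of a dilation invariant interaction are real powers of conformal time. -/
lemma coeff_eq_zpow {ι : Type*} (O : LocalInteraction ι) (hO : O.DilationInvariant)
    (m : Jet ι →₀ ℕ) :
    ∃ c : ℝ, ∀ τ : ℂ, τ.re < 0 →
      O.lag.coeff m τ = c * (-τ) ^ ((derivCount m : ℤ) - 4) := by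
  -- At `τ = -1` the power of `-τ` is one, so the constant is the coefficient there, which is real.
  refine ⟨(O.lag.coeff m (-1 : ℂ)).re, ?_⟩
  have hre : (((O.lag.coeff m (-1 : ℂ)).re : ℝ) : ℂ) = O.lag.coeff m (-1 : ℂ) := by
    refine Complex.ext rfl ?_
    have := O.real m (-1) (by norm_num)
    push_cast at this
    simp [this]
  rw [hre]
  have hopen : IsOpen {τ : ℂ | τ.re < 0} := isOpen_lt Complex.continuous_re continuous_const
  have hconn : IsPreconnected {τ : ℂ | τ.re < 0} := (convex_halfSpace_re_lt 0).isPreconnected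
  have hf := (O.holomorphic m).analyticOnNhd hopen
  have hg : AnalyticOnNhd ℂ (fun τ : ℂ => O.lag.coeff m (-1 : ℂ) *
      (-τ) ^ ((derivCount m : ℤ) - 4)) {τ : ℂ | τ.re < 0} := by
    refine DifferentiableOn.analyticOnNhd (fun τ (hτ : τ.re < 0) => ?_) hopen
    have h0 : -τ ≠ 0 := by
      rintro h
      rw [neg_eq_zero.1 h] at hτ
      simp at hτ
    have h1 : DifferentiableAt ℂ (fun τ : ℂ => (-τ) ^ ((derivCount m : ℤ) - 4)) τ :=
      (differentiableAt_zpow.2 (Or.inl h0)).comp τ differentiableAt_fun_id.fun_neg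
    exact (h1.const_mul _).differentiableWithinAt
  -- Scaling fixes the coefficient on the negative real axis; the identity theorem extends this to
  -- the half plane that contains the tilted contour.
  have hEq := hf.eqOn_of_preconnected_of_frequently_eq hg hconn (z₀ := -1) (by simp) ?_
  · exact fun τ hτ => hEq hτ
  · have hfreq : ∃ᶠ x : ℝ in 𝓝[≠] (-1 : ℝ), O.lag.coeff m (x : ℂ) =
        O.lag.coeff m (-1 : ℂ) * (-(x : ℂ)) ^ ((derivCount m : ℤ) - 4) := by
      refine Eventually.frequently ?_
      filter_upwards [nhdsWithin_le_nhds (gt_mem_nhds (show (-1 : ℝ) < 0 by norm_num))] with x hx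
      -- Every `x < 0` is reached from `τ = -1` by the dilation `l = -x`.
      have h := coeff_scaling O hO (neg_pos.2 hx) (show (-1 : ℝ) < 0 by norm_num) m
      have hx0 : (-(x : ℂ)) ≠ 0 := by exact_mod_cast (neg_pos.2 hx).ne'
      simp only [mul_neg, mul_one, neg_neg] at h
      push_cast at h
      rw [zpow_sub₀ hx0, ← mul_div_assoc, zpow_natCast, h]
      rw [eq_div_iff (zpow_ne_zero _ hx0)]
      norm_cast
      ring
    have ht : Tendsto (fun x : ℝ => (x : ℂ)) (𝓝[≠] (-1 : ℝ)) (𝓝[≠] (-1 : ℂ)) := by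
      refine tendsto_nhdsWithin_iff.2 ⟨?_, ?_⟩
      · have := Complex.continuous_ofReal.tendsto (-1 : ℝ)
        push_cast at this
        exact this.mono_left nhdsWithin_le_nhds
      · filter_upwards [self_mem_nhdsWithin] with x hx h
        refine hx (Complex.ofReal_injective ?_)
        simpa using h
    exact ht.frequently hfreq

/-! ### Propagators on the tilted contour -/

lemma expTerm_mul (i j : ℝ × ℤ) {u : ℂ} (hu : u ≠ 0) :
    expTerm i u * expTerm j u = expTerm (i + j) u := by
  simp only [expTerm, Prod.fst_add, Prod.snd_add, zpow_add₀ hu]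
  rw [show -(((i.1 + j.1 : ℝ) : ℂ) * u) = -(i.1 * u) + -(j.1 * u) by push_cast; ring,
    Complex.exp_add]
  ring

lemma hasDerivAt_expTerm (i : ℝ × ℤ) {u : ℂ} (hu : u ≠ 0) :
    HasDerivAt (expTerm i) (i.2 * expTerm (i.1, i.2 - 1) u - i.1 * expTerm i u) u := by
  have h1 := hasDerivAt_zpow i.2 u (Or.inl hu)
  have h2 : HasDerivAt (fun u : ℂ => Complex.exp (-(i.1 * u)))
      (Complex.exp (-(i.1 * u)) * -(i.1 * 1)) u :=
    (((hasDerivAt_id u).const_mul (i.1 : ℂ)).neg).cexp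
  refine (h1.mul h2).congr_deriv ?_
  simp only [expTerm]
  ring

/-- The functions of two contour parameters that are generated by real functions of the ratio of
the parameters, integer powers, and real exponentials of `ζ s₁` and `ζ s₂`. -/
inductive IsRealTwoPoint (ζ : ℂ) : (ℝ → ℝ → ℂ) → Prop
  | term (t : ℝ → ℝ) (ht : ContDiff ℝ ∞ t) (i j : ℝ × ℤ) :
      IsRealTwoPoint ζ fun s₁ s₂ =>
        (t (Real.log (s₂ / s₁)) : ℂ) * (expTerm i (ζ * s₁) * expTerm j (ζ * s₂))
  | add {F G : ℝ → ℝ → ℂ} : IsRealTwoPoint ζ F → IsRealTwoPoint ζ G →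
      IsRealTwoPoint ζ fun s₁ s₂ => F s₁ s₂ + G s₁ s₂
  | congr {F G : ℝ → ℝ → ℂ} : IsRealTwoPoint ζ F →
      (∀ s₁ s₂, 0 < s₁ → 0 < s₂ → G s₁ s₂ = F s₁ s₂) → IsRealTwoPoint ζ G

namespace IsRealTwoPoint

variable {ζ : ℂ} {F G : ℝ → ℝ → ℂ}

lemma swap (hF : IsRealTwoPoint ζ F) : IsRealTwoPoint ζ fun s₁ s₂ => F s₂ s₁ := by
  induction hF with
  | term t ht i j =>
    refine (term (fun x => t (-x)) (ht.comp contDiff_neg) j i).congr fun s₁ s₂ _ _ => ?_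
    dsimp only
    rw [← Real.log_inv, inv_div, mul_comm (expTerm i _)]
  | add _ _ h1 h2 => exact h1.add h2
  | congr _ h ih => exact ih.congr fun s₁ s₂ h1 h2 => h s₂ s₁ h2 h1

lemma mul (hζ : ζ ≠ 0) (hF : IsRealTwoPoint ζ F) (hG : IsRealTwoPoint ζ G) :
    IsRealTwoPoint ζ fun s₁ s₂ => F s₁ s₂ * G s₁ s₂ := by
  induction hF with
  | term t ht i j =>
    induction hG with
    | term t' ht' i' j' =>
      refine (term (fun x => t x * t' x) (ht.mul ht') (i + i') (j + j')).congr
        fun s₁ s₂ h1 h2 => ?_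
      rw [← expTerm_mul _ _ (mul_ne_zero hζ (by exact_mod_cast h1.ne')),
        ← expTerm_mul _ _ (mul_ne_zero hζ (by exact_mod_cast h2.ne'))]
      push_cast
      ring
    | add _ _ h1 h2 => exact (h1.add h2).congr fun _ _ _ _ => mul_add _ _ _
    | congr _ h ih => exact ih.congr fun s₁ s₂ h1 h2 => by rw [h s₁ s₂ h1 h2]
  | add _ _ h1 h2 => exact (h1.add h2).congr fun _ _ _ _ => add_mul _ _ _
  | congr _ h ih => exact ih.congr fun s₁ s₂ h1 h2 => by rw [h s₁ s₂ h1 h2]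

lemma profile {t : ℝ → ℝ} (ht : ContDiff ℝ ∞ t) :
    IsRealTwoPoint ζ fun s₁ s₂ => (t (Real.log (s₂ / s₁)) : ℂ) :=
  (term t ht (0, 0) (0, 0)).congr fun s₁ s₂ _ _ => by simp [expTerm]

lemma const (b : ℝ) : IsRealTwoPoint ζ fun _ _ => (b : ℂ) :=
  profile (t := fun _ => b) contDiff_const

lemma expTerm_left (i : ℝ × ℤ) : IsRealTwoPoint ζ fun s₁ _ => expTerm i (ζ * s₁) :=
  (term (fun _ => 1) contDiff_const i (0, 0)).congr fun s₁ s₂ _ _ => by simp [expTerm]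

lemma linear_mul_exp_left (a b : ℝ) :
    IsRealTwoPoint ζ fun s₁ _ => (1 + a * (ζ * s₁)) * Complex.exp (b * (ζ * s₁)) := by
  refine ((expTerm_left (-b, 0)).add
    (term (fun _ => a) contDiff_const (-b, 1) (0, 0))).congr fun s₁ s₂ _ _ => ?_
  simp [expTerm]
  ring

lemma linear_mul_exp_right (a b : ℝ) :
    IsRealTwoPoint ζ fun _ s₂ => (1 + a * (ζ * s₂)) * Complex.exp (b * (ζ * s₂)) :=
  (linear_mul_exp_left a b).swap

/-- Differentiating the profile gives `-t' / s₁ = ζ * (-t') * (ζ s₁)⁻¹`, and differentiating a term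
in `ζ s₁` also gives a factor `ζ`. Hence `ζ⁻¹ ∂_s`, the derivative in `x = ζ s`, preserves the
class, including the contact terms. Negative powers enter here. Differentiability is carried along
for the sum rule. -/
lemma deriv_left (hζ : ζ ≠ 0) (hF : IsRealTwoPoint ζ F) :
    (∀ s₁ s₂, 0 < s₁ → 0 < s₂ → DifferentiableAt ℝ (fun u => F u s₂) s₁) ∧
      IsRealTwoPoint ζ fun s₁ s₂ => ζ⁻¹ * deriv (fun u => F u s₂) s₁ := by
  induction hF with
  | term t ht i j =>
    have hd : ∀ s₁ s₂ : ℝ, 0 < s₁ → 0 < s₂ → HasDerivAt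
        (fun u : ℝ => (t (Real.log (s₂ / u)) : ℂ) * (expTerm i (ζ * u) * expTerm j (ζ * s₂)))
        (((deriv t (Real.log (s₂ / s₁)) * -s₁⁻¹ : ℝ) : ℂ) *
            (expTerm i (ζ * s₁) * expTerm j (ζ * s₂)) +
          (t (Real.log (s₂ / s₁)) : ℂ) * ((ζ * (i.2 * expTerm (i.1, i.2 - 1) (ζ * s₁) -
            i.1 * expTerm i (ζ * s₁))) * expTerm j (ζ * s₂))) s₁ := by
      intro s₁ s₂ h1 h2
      have hlog : HasDerivAt (fun u : ℝ => Real.log (s₂ / u)) (-s₁⁻¹) s₁ := by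
        have h3 := ((hasDerivAt_inv h1.ne').const_mul s₂).log
          (mul_ne_zero h2.ne' (inv_ne_zero h1.ne'))
        simp only [← div_eq_mul_inv] at h3
        refine h3.congr_deriv ?_
        field_simp
      have ht' : HasDerivAt t (deriv t (Real.log (s₂ / s₁))) (Real.log (s₂ / s₁)) :=
        (ht.differentiable (by simp) _).hasDerivAt
      have h3 := (ht'.comp s₁ hlog).ofReal_comp
      have h4 : HasDerivAt (fun u : ℝ => ζ * (u : ℂ)) ζ s₁ := by
        simpa using (Complex.ofRealCLM.hasDerivAt (x := s₁)).const_mul ζ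
      have h5 := ((hasDerivAt_expTerm i (mul_ne_zero hζ (by exact_mod_cast h1.ne' :
        (s₁ : ℂ) ≠ 0))).comp_of_eq s₁ h4 rfl).mul_const (expTerm j (ζ * s₂))
      refine (h3.mul h5).congr_deriv ?_
      simp only [Function.comp]
      ring
    refine ⟨fun s₁ s₂ h1 h2 => (hd s₁ s₂ h1 h2).differentiableAt, ?_⟩
    have hdt : ContDiff ℝ ∞ (fun x => -deriv t x) :=
      ((contDiff_infty_iff_deriv.1 ht).2).neg
    refine ((term _ hdt (i + (0, -1)) j).add
      ((term (fun x => i.2 * t x) (contDiff_const.mul ht) (i.1, i.2 - 1) j).add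
        (term (fun x => -i.1 * t x) (contDiff_const.mul ht) i j))).congr fun s₁ s₂ h1 h2 => ?_
    have h1' : (s₁ : ℂ) ≠ 0 := by exact_mod_cast h1.ne'
    rw [(hd s₁ s₂ h1 h2).deriv, ← expTerm_mul _ _ (mul_ne_zero hζ h1')]
    have : expTerm (0, -1) (ζ * s₁) = ζ⁻¹ * (s₁ : ℂ)⁻¹ := by
      simp [expTerm, mul_comm]
    rw [this]
    push_cast
    field_simp
    ring
  | @add F G _ _ h1 h2 =>
    refine ⟨fun s₁ s₂ p1 p2 => (h1.1 s₁ s₂ p1 p2).add (h2.1 s₁ s₂ p1 p2), ?_⟩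
    refine (h1.2.add h2.2).congr fun s₁ s₂ p1 p2 => ?_
    rw [deriv_fun_add (h1.1 s₁ s₂ p1 p2) (h2.1 s₁ s₂ p1 p2), mul_add]
  | @congr F G _ h ih =>
    have he : ∀ s₁ s₂, 0 < s₁ → 0 < s₂ → (fun u => G u s₂) =ᶠ[𝓝 s₁] fun u => F u s₂ := by
      intro s₁ s₂ h1 h2
      filter_upwards [lt_mem_nhds h1] with u hu using h u s₂ hu h2
    refine ⟨fun s₁ s₂ h1 h2 => (ih.1 s₁ s₂ h1 h2).congr_of_eventuallyEq (he s₁ s₂ h1 h2),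
      ih.2.congr fun s₁ s₂ h1 h2 => ?_⟩
    rw [(he s₁ s₂ h1 h2).deriv_eq]

lemma iteratedDeriv_left (hζ : ζ ≠ 0) (hF : IsRealTwoPoint ζ F) (n : ℕ) :
    IsRealTwoPoint ζ fun s₁ s₂ => ζ⁻¹ ^ n * iteratedDeriv n (fun u => F u s₂) s₁ := by
  induction n with
  | zero => simpa using hF
  | succ n ih =>
    refine (ih.deriv_left hζ).2.congr fun s₁ s₂ _ _ => ?_
    rw [deriv_const_mul_field, iteratedDeriv_succ]
    ring

lemma iteratedDeriv_right (hζ : ζ ≠ 0) (hF : IsRealTwoPoint ζ F) (n : ℕ) :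
    IsRealTwoPoint ζ fun s₁ s₂ => ζ⁻¹ ^ n * iteratedDeriv n (fun u => F s₁ u) s₂ :=
  (hF.swap.iteratedDeriv_left hζ n).swap

end IsRealTwoPoint

/-- The direction of the contour, seen from the positive imaginary axis of conformal time. -/
def rayDir (ε : ℝ) : ℂ := ε + Complex.I

lemma rayDir_re (ε : ℝ) : (rayDir ε).re = ε := by simp [rayDir]

lemma rayDir_ne_zero (ε : ℝ) : rayDir ε ≠ 0 := fun h => by
  simpa [rayDir] using congrArg Complex.im h

lemma tilt_eq (ε : ℝ) : tilt ε = -Complex.I * rayDir ε := by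
  simp only [tilt, rayDir, mul_add, neg_mul, Complex.I_mul_I]
  ring

/-- The Wick rotation: in `x = -iτ` the contour is the ray through `rayDir ε`. -/
lemma contour_eq (ε s : ℝ) : contour ε s = Complex.I * (rayDir ε * s) := by
  rw [contour, tilt_eq]
  ring

/-- This is `∂_τ = -i ∂_x` with `x = ζ s`: one phase `-i` per time derivative, and otherwise a real
operation. -/
lemma tauDeriv_eq (ε : ℝ) (n : ℕ) (f : ℝ → ℂ) (s : ℝ) :
    tauDeriv ε n f s = (-Complex.I) ^ n * ((rayDir ε)⁻¹ ^ n * iteratedDeriv n f s) := by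
  rw [tauDeriv, tilt_eq, ← mul_assoc, ← mul_pow]
  congr 2
  rw [one_div, mul_inv, inv_neg, Complex.inv_I]
  ring

lemma isRealTwoPoint_bulkToBoundary (ε k : ℝ) :
    IsRealTwoPoint (rayDir ε) fun s₁ _ => bulkToBoundary k (contour ε s₁) := by
  refine (IsRealTwoPoint.linear_mul_exp_left k (-k)).congr fun s₁ s₂ _ _ => ?_
  have h : Complex.I * k * contour ε s₁ = -(k * (rayDir ε * s₁)) := by
    rw [contour_eq]
    linear_combination (k * (rayDir ε * s₁) : ℂ) * Complex.I_mul_I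
  rw [bulkToBoundary, h]
  push_cast
  ring_nf

lemma isRealTwoPoint_wightman (ε H k : ℝ) :
    IsRealTwoPoint (rayDir ε) fun s₁ s₂ => wightman H k (contour ε s₁) (contour ε s₂) := by
  have hζ := rayDir_ne_zero ε
  refine (((IsRealTwoPoint.const (H ^ 2 / (2 * k ^ 3))).mul hζ
    (IsRealTwoPoint.linear_mul_exp_left (-k) k)).mul hζ
    (IsRealTwoPoint.linear_mul_exp_right k (-k))).congr fun s₁ s₂ _ _ => ?_
  have h : ∀ s : ℝ, Complex.I * k * contour ε s = -(k * (rayDir ε * s)) := fun s => by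
    rw [contour_eq]
    linear_combination (k * (rayDir ε * s) : ℂ) * Complex.I_mul_I
  rw [wightman, mul_sub (Complex.I * k), h, h, neg_sub, sub_eq_add_neg,
    sub_eq_add_neg, Complex.exp_add]
  push_cast
  ring_nf

lemma isRealTwoPoint_boundaryTerm (ε H k : ℝ) :
    IsRealTwoPoint (rayDir ε) fun s₁ s₂ => -boundaryTerm H k (contour ε s₁) (contour ε s₂) := by
  have hζ := rayDir_ne_zero ε
  refine (((IsRealTwoPoint.const (-(H ^ 2 / (2 * k ^ 3)))).mul hζ
    (IsRealTwoPoint.linear_mul_exp_left k (-k))).mul hζ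
    (IsRealTwoPoint.linear_mul_exp_right k (-k))).congr fun s₁ s₂ _ _ => ?_
  have h : ∀ s : ℝ, Complex.I * k * contour ε s = -(k * (rayDir ε * s)) := fun s => by
    rw [contour_eq]
    linear_combination (k * (rayDir ε * s) : ℂ) * Complex.I_mul_I
  rw [boundaryTerm, mul_add, h, h, Complex.exp_add]
  push_cast
  ring_nf

lemma isRealTwoPoint_bulkToBulk (H : ℝ) (θ : StepProfile) (ε σ k : ℝ) :
    IsRealTwoPoint (rayDir ε) (bulkToBulk H θ ε σ k) := by
  have hζ := rayDir_ne_zero ε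
  have ht : IsRealTwoPoint (rayDir ε) fun s₁ s₂ => (smoothStep θ σ s₁ s₂ : ℂ) :=
    IsRealTwoPoint.profile (t := fun x => θ.toFun (x / σ))
      (θ.smooth.comp (contDiff_id.div_const σ))
  have hw := isRealTwoPoint_wightman ε H k
  refine (((hw.mul hζ ht).add (hw.swap.mul hζ ht.swap)).add
    (isRealTwoPoint_boundaryTerm ε H k)).congr fun s₁ s₂ _ _ => ?_
  rw [bulkToBulk, sub_eq_add_neg]

/-- A function of one time is treated as a two-point function constant in its second argument, hence
the diagonal `F s s`. -/
lemma exists_bulkToBoundary_deriv (ε k : ℝ) (n : ℕ) :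
    ∃ F, IsRealTwoPoint (rayDir ε) F ∧ ∀ s,
      tauDeriv ε n (fun u => bulkToBoundary k (contour ε u)) s = (-Complex.I) ^ n * F s s :=
  ⟨_, (isRealTwoPoint_bulkToBoundary ε k).iteratedDeriv_left (rayDir_ne_zero ε) n, fun s => by
    rw [tauDeriv_eq]⟩

lemma exists_bulkToBulkDeriv (H : ℝ) (θ : StepProfile) (ε σ k : ℝ) (n m : ℕ) :
    ∃ F, IsRealTwoPoint (rayDir ε) F ∧ ∀ s₁ s₂,
      bulkToBulkDeriv H θ ε σ k n m s₁ s₂ = (-Complex.I) ^ n * (-Complex.I) ^ m * F s₁ s₂ := by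
  refine ⟨_, ((isRealTwoPoint_bulkToBulk H θ ε σ k).iteratedDeriv_right
    (rayDir_ne_zero ε) m).iteratedDeriv_left (rayDir_ne_zero ε) n, fun s₁ s₂ => ?_⟩
  simp only [bulkToBulkDeriv, tauDeriv_eq]
  rw [iteratedDeriv_const_mul_field]
  ring

/-! ### The integrand along rays -/

/-- A function on the positive half line that is a real exponential sum of `ζ r`. -/
def IsRayReal (ζ : ℂ) (f : ℝ → ℂ) : Prop :=
  ∃ c : ℝ × ℤ →₀ ℝ, ∀ r : ℝ, 0 < r → f r = expSum c (ζ * r)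

lemma expSum_single (i : ℝ × ℤ) (b : ℝ) (u : ℂ) :
    expSum (Finsupp.single i b) u = b * expTerm i u :=
  Finsupp.sum_single_index (by simp)

lemma expSum_add (c d : ℝ × ℤ →₀ ℝ) (u : ℂ) : expSum (c + d) u = expSum c u + expSum d u :=
  Finsupp.sum_add_index' (by simp) (by intros; push_cast; ring)

namespace IsRayReal

variable {ζ : ℂ} {f g : ℝ → ℂ}

lemma congr (hf : IsRayReal ζ f) (h : ∀ r, 0 < r → g r = f r) : IsRayReal ζ g := by
  obtain ⟨c, hc⟩ := hf
  exact ⟨c, fun r hr => (h r hr).trans (hc r hr)⟩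

lemma single (b : ℝ) (i : ℝ × ℤ) : IsRayReal ζ fun r => b * expTerm i (ζ * r) :=
  ⟨Finsupp.single i b, fun _ _ => (expSum_single i b _).symm⟩

lemma const (b : ℝ) : IsRayReal ζ fun _ => (b : ℂ) :=
  (single b (0, 0)).congr fun _ _ => by simp [expTerm]

lemma add (hf : IsRayReal ζ f) (hg : IsRayReal ζ g) : IsRayReal ζ fun r => f r + g r := by
  obtain ⟨c, hc⟩ := hf
  obtain ⟨d, hd⟩ := hg
  exact ⟨c + d, fun r hr => by dsimp only; rw [expSum_add, hc r hr, hd r hr]⟩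

lemma finset_sum {κ : Type*} (s : Finset κ) {f : κ → ℝ → ℂ} (h : ∀ i ∈ s, IsRayReal ζ (f i)) :
    IsRayReal ζ fun r => ∑ i ∈ s, f i r := by
  classical
  induction s using Finset.induction_on with
  | empty => exact (const 0).congr fun r _ => by simp
  | insert a s ha ih =>
    refine ((h a (Finset.mem_insert_self a s)).add
      (ih fun i hi => h i (Finset.mem_insert_of_mem hi))).congr fun r _ => ?_
    rw [Finset.sum_insert ha]

lemma mul (hζ : ζ ≠ 0) (hf : IsRayReal ζ f) (hg : IsRayReal ζ g) :
    IsRayReal ζ fun r => f r * g r := by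
  obtain ⟨c, hc⟩ := hf
  obtain ⟨d, hd⟩ := hg
  refine (finset_sum c.support fun i _ => finset_sum d.support fun j _ =>
    single (c i * d j) (i + j)).congr fun r hr => ?_
  rw [hc r hr, hd r hr, expSum_eq, expSum_eq, Finset.sum_mul_sum]
  refine Finset.sum_congr rfl fun i _ => Finset.sum_congr rfl fun j _ => ?_
  rw [← expTerm_mul _ _ (mul_ne_zero hζ (by exact_mod_cast hr.ne'))]
  push_cast
  ring

lemma finset_prod (hζ : ζ ≠ 0) {κ : Type*} (s : Finset κ) {f : κ → ℝ → ℂ}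
    (h : ∀ i ∈ s, IsRayReal ζ (f i)) : IsRayReal ζ fun r => ∏ i ∈ s, f i r := by
  classical
  induction s using Finset.induction_on with
  | empty => exact (const 1).congr fun r _ => by simp
  | insert a s ha ih =>
    refine ((h a (Finset.mem_insert_self a s)).mul hζ
      (ih fun i hi => h i (Finset.mem_insert_of_mem hi))).congr fun r _ => ?_
    rw [Finset.prod_insert ha]

lemma expTerm_scaled (i : ℝ × ℤ) (w : ℝ) :
    IsRayReal ζ fun r => expTerm i (ζ * (r * w : ℝ)) := by
  refine (single (w ^ i.2) (i.1 * w, i.2)).congr fun r _ => ?_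
  rw [expTerm, expTerm, Complex.ofReal_mul, ← mul_assoc, mul_zpow]
  push_cast
  ring_nf

end IsRayReal

/-- Along a ray the ratio of the two parameters is fixed, so the non-analytic profile collapses to a
real constant and only powers and exponentials depend on `r`. -/
lemma IsRealTwoPoint.isRayReal {ζ : ℂ} (hζ : ζ ≠ 0) {F : ℝ → ℝ → ℂ} (hF : IsRealTwoPoint ζ F)
    {w₁ w₂ : ℝ} (h₁ : 0 < w₁) (h₂ : 0 < w₂) : IsRayReal ζ fun r => F (r * w₁) (r * w₂) := by
  induction hF with
  | term t ht i j =>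
    refine ((IsRayReal.const (t (Real.log (w₂ / w₁)))).mul hζ
      ((IsRayReal.expTerm_scaled i w₁).mul hζ (IsRayReal.expTerm_scaled j w₂))).congr
      fun r hr => ?_
    dsimp only
    rw [mul_div_mul_left _ _ hr.ne']
  | add _ _ h1 h2 => exact h1.add h2
  | congr _ h ih =>
    exact ih.congr fun r hr => h _ _ (mul_pos hr h₁) (mul_pos hr h₂)

namespace TreeDiagram

variable {ι : Type*} {E : ℕ}

open Classical in
lemma derivCount_vertexMonomial (D : TreeDiagram ι E) (j : Fin E ⊕ D.graph.Dart → Jet ι)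
    (v : Fin D.V) :
    derivCount (D.vertexMonomial j v) =
      ∑ h ∈ Finset.univ.filter (fun h => D.vertex h = v), jetOrder (j h) := by
  rw [vertexMonomial, map_sum]
  refine Finset.sum_congr rfl fun h _ => ?_
  simp [derivCount, Finsupp.weight_single]

/-- The measure gives `i * tilt ε = ζ`, and the coupling gives a real power of `-τ = -i ζ s`. Apart
from `ζ`, the only phase is thus `-i` per derivative in the monomial. -/
lemma exists_vertexFactor (D : TreeDiagram ι E) (hD : ∀ v, (D.interaction v).DilationInvariant)
    (ε : ℝ) (j : Fin E ⊕ D.graph.Dart → Jet ι) (v : Fin D.V) {w : ℝ} (hw : 0 < w) :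
    ∃ f, IsRayReal (rayDir ε) f ∧ ∀ r, 0 < r → D.vertexFactor ε j v (r * w) =
      rayDir ε * ((-Complex.I) ^ derivCount (D.vertexMonomial j v) * f r) := by
  have hζ := rayDir_ne_zero ε
  obtain ⟨c, hc⟩ := coeff_eq_zpow (D.interaction v) (hD v) (D.vertexMonomial j v)
  refine ⟨_, (IsRayReal.const (((D.vertexMonomial j v).prod fun _ n => (Nat.factorial n : ℝ)) * c)).mul
    hζ (IsRayReal.expTerm_scaled (0, (derivCount (D.vertexMonomial j v) : ℤ) - 4) w),
    fun r hr => ?_⟩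
  have hre : (contour ε (r * w)).re < 0 := by
    have := mul_pos hr hw
    simp [contour, tilt]
    exact this
  have hneg : -contour ε (r * w) = -Complex.I * (rayDir ε * (r * w : ℝ)) := by
    rw [contour_eq]; ring
  -- The shift by `4`, the weight of `dτ d³x`, costs no phase because `(-i)^4 = 1`.
  have hI : (-Complex.I) ^ ((derivCount (D.vertexMonomial j v) : ℤ) - 4) =
      (-Complex.I) ^ derivCount (D.vertexMonomial j v) := by
    rw [zpow_sub₀ (neg_ne_zero.2 Complex.I_ne_zero), zpow_natCast]
    have : (-Complex.I) ^ (4 : ℤ) = 1 := by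
      norm_cast
      rw [Even.neg_pow (by decide), Complex.I_pow_four]
    rw [this, div_one]
  rw [vertexFactor, hc _ hre, hneg, mul_zpow, hI, tilt_eq]
  simp only [expTerm, Finsupp.prod]
  push_cast
  have h1 : Complex.I * (-Complex.I * rayDir ε) = rayDir ε := by
    linear_combination (-rayDir ε) * Complex.I_mul_I
  rw [h1]
  simp
  ring

lemma exists_momentumFactor (p : Space) (α : Fin 3 → ℕ) :
    ∃ b : ℝ, momentumFactor p α = Complex.I ^ (α 0 + (α 1 + α 2)) * b := by
  refine ⟨∏ a, p a ^ α a, ?_⟩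
  simp only [momentumFactor, Fin.prod_univ_three, mul_pow, pow_add]
  push_cast
  ring

open Classical in
/-- A product over the internal lines of factors for both ends is a product over the darts. -/
lemma prod_internal_lines (D : TreeDiagram ι E) (g : D.graph.Dart → ℂ) :
    ∏ d ∈ Finset.univ.filter (fun d : D.graph.Dart => d.fst < d.snd), g d * g d.symm =
      ∏ d, g d := by
  rw [Finset.prod_mul_distrib,
    ← Finset.prod_filter_mul_prod_filter_not Finset.univ (fun d : D.graph.Dart => d.fst < d.snd) g]
  congr 1
  refine Finset.prod_nbij' (fun d => d.symm) (fun d => d.symm) ?_ ?_ ?_ ?_ ?_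
  · intro d hd
    simpa using (Finset.mem_filter.1 hd).2.le
  · intro d hd
    have h1 := (Finset.mem_filter.1 hd).2
    have h2 : d.fst ≠ d.snd := d.fst_ne_snd
    simpa using lt_of_le_of_ne (not_lt.1 h1) h2.symm
  · simp
  · simp
  · simp

open Classical in
lemma prod_phase_vertices (D : TreeDiagram ι E) (j : Fin E ⊕ D.graph.Dart → Jet ι) (z : ℂ) :
    ∏ v, z ^ derivCount (D.vertexMonomial j v) = ∏ h, z ^ jetOrder (j h) := by
  rw [Finset.prod_pow_eq_pow_sum, Finset.prod_pow_eq_pow_sum]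
  simp only [derivCount_vertexMonomial]
  rw [Finset.sum_fiberwise]

/-- The three factors are the share of the coupling at the vertex, the momentum factor, and the time
derivatives of the propagator. Spatial derivatives cancel through `(-i) i = 1`, and each time
derivative leaves `(-i)² = -1`. -/
lemma phase_halfEdge {ι : Type*} (J : Jet ι) :
    (-Complex.I) ^ jetOrder J * Complex.I ^ (J.2.2 0 + (J.2.2 1 + J.2.2 2)) *
      (-Complex.I) ^ J.2.1 = ((-1 : ℝ) ^ J.2.1 : ℝ) := by
  rw [jetOrder, pow_add, mul_assoc ((-Complex.I) ^ J.2.1), ← mul_pow, mul_right_comm, ← mul_pow]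
  simp

/-- Along every ray in the domain, the integrand with the polar Jacobian is a real exponential
sum in the rotated parameter. -/
theorem exists_integrand_ray (D : TreeDiagram ι E)
    (hD : ∀ v, (D.interaction v).DilationInvariant) (H : ℝ) (θ : StepProfile) (ε σ : ℝ)
    {w : Fin D.V → ℝ} (hw : w ∈ D.domain) :
    ∃ c : ℝ × ℤ →₀ ℝ, ∀ r : ℝ, 0 < r →
      ((r ^ (D.V - 1) : ℝ) : ℂ) * D.integrand H θ ε σ (r • w) =
        rayDir ε * expSum c (rayDir ε * r) := by
  classical
  have hζ := rayDir_ne_zero ε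
  have hV : 0 < D.V := by
    obtain ⟨v⟩ := D.isTree.connected.nonempty
    exact v.pos
  suffices h : IsRayReal (rayDir ε) fun r => (rayDir ε)⁻¹ *
      (((r ^ (D.V - 1) : ℝ) : ℂ) * D.integrand H θ ε σ (r • w)) by
    obtain ⟨c, hc⟩ := h
    exact ⟨c, fun r hr => by rw [← hc r hr, mul_inv_cancel_left₀ hζ]⟩
  have hj : ∀ j : Fin E ⊕ D.graph.Dart → Jet ι, IsRayReal (rayDir ε) fun r =>
      (rayDir ε)⁻¹ * (((r ^ (D.V - 1) : ℝ) : ℂ) *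
    ((∏ v, D.vertexFactor ε j v ((r • w) v)) *
    (∏ h, momentumFactor (D.momentum h) (j h).2.2) *
    (∏ e : Fin E, tauDeriv ε (j (Sum.inl e)).2.1
      (fun u => bulkToBoundary ‖D.momentum (Sum.inl e)‖ (contour ε u)) ((r • w) (D.attach e))) *
    (∏ d ∈ Finset.univ.filter (fun d : D.graph.Dart => d.fst < d.snd),
      bulkToBulkDeriv H θ ε σ ‖D.momentum (Sum.inr d)‖
        (j (Sum.inr d)).2.1 (j (Sum.inr d.symm)).2.1 ((r • w) d.fst) ((r • w) d.snd)))) := by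
    intro j
    choose Rv hRv hv using fun v => D.exists_vertexFactor hD ε j v (hw v)
    choose b hb using fun h => exists_momentumFactor (D.momentum h) (j h).2.2
    choose Fe hFe he using fun e : Fin E =>
      exists_bulkToBoundary_deriv ε ‖D.momentum (Sum.inl e)‖ (j (Sum.inl e)).2.1
    choose Fd hFd hd using fun d : D.graph.Dart =>
      exists_bulkToBulkDeriv H θ ε σ ‖D.momentum (Sum.inr d)‖ (j (Sum.inr d)).2.1
        (j (Sum.inr d.symm)).2.1
    have hreal : IsRayReal (rayDir ε) fun r =>
        expTerm (0, ((D.V - 1 : ℕ) : ℤ)) (rayDir ε * (r * (1 : ℝ) : ℝ)) *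
        ((∏ h, (((-1 : ℝ) ^ (j h).2.1 : ℝ) : ℂ) * (b h : ℂ)) * ((∏ v, Rv v r) *
        ((∏ e, Fe e (r * w (D.attach e)) (r * w (D.attach e))) *
        ∏ d ∈ Finset.univ.filter (fun d : D.graph.Dart => d.fst < d.snd),
          Fd d (r * w d.fst) (r * w d.snd)))) :=
      (IsRayReal.expTerm_scaled _ _).mul hζ
        ((IsRayReal.finset_prod hζ _ fun h _ => (IsRayReal.const _).mul hζ (IsRayReal.const _)).mul hζ
        ((IsRayReal.finset_prod hζ _ fun v _ => hRv v).mul hζ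
        ((IsRayReal.finset_prod hζ _ fun e _ => (hFe e).isRayReal hζ (hw _) (hw _)).mul hζ
        (IsRayReal.finset_prod hζ _ fun d _ => (hFd d).isRayReal hζ (hw _) (hw _)))))
    refine hreal.congr fun r hr => ?_
    -- All phases are redistributed over half-edges: those of a vertex over the half-edges that end
    -- there, those of an internal line over its two darts.
    have hphase : (∏ v, (-Complex.I) ^ derivCount (D.vertexMonomial j v)) *
        (∏ h, Complex.I ^ ((j h).2.2 0 + ((j h).2.2 1 + (j h).2.2 2))) *
        ((∏ e, (-Complex.I) ^ (j (Sum.inl e)).2.1) *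
        (∏ d ∈ Finset.univ.filter (fun d : D.graph.Dart => d.fst < d.snd),
          (-Complex.I) ^ (j (Sum.inr d)).2.1 * (-Complex.I) ^ (j (Sum.inr d.symm)).2.1)) =
        ∏ h, (((-1 : ℝ) ^ (j h).2.1 : ℝ) : ℂ) := by
      rw [prod_phase_vertices,
        D.prod_internal_lines (fun d => (-Complex.I) ^ (j (Sum.inr d)).2.1),
        ← Fintype.prod_sum_type (fun h => (-Complex.I) ^ (j h).2.1), ← Finset.prod_mul_distrib,
        ← Finset.prod_mul_distrib]
      exact Finset.prod_congr rfl fun h _ => phase_halfEdge (j h)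
    -- Of the `V` factors `ζ` from the vertices, `V - 1` turn the Jacobian `r ^ (V - 1)` into a
    -- power of `ζ r`; the last one belongs to `ζ dr`.
    have hpow : (rayDir ε)⁻¹ * ((r ^ (D.V - 1) : ℝ) * rayDir ε ^ D.V) =
        expTerm (0, ((D.V - 1 : ℕ) : ℤ)) (rayDir ε * (r * (1 : ℝ) : ℝ)) := by
      obtain ⟨n, hn⟩ : ∃ n, D.V = n + 1 := ⟨D.V - 1, by omega⟩
      simp only [expTerm, hn, Nat.add_sub_cancel, zpow_natCast, mul_one, Complex.ofReal_zero,
        zero_mul, neg_zero, Complex.exp_zero, pow_succ, mul_pow, Complex.ofReal_pow]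
      field_simp
    simp only [Pi.smul_apply, smul_eq_mul, hb, he, hd, hv _ r hr, Finset.prod_mul_distrib,
      Finset.prod_const, Finset.card_univ, Fintype.card_fin]
    rw [← hpow, ← hphase]
    simp only [Finset.prod_mul_distrib]
    ring
  refine (IsRayReal.finset_sum D.contractions fun j _ => hj j).congr fun r _ => ?_
  rw [integrand, Finset.mul_sum, Finset.mul_sum]

end TreeDiagram

/-! ### Polar coordinates and the theorem -/

lemma integral_volumeIoiPow (n : ℕ) (f : ℝ → ℂ) :
    ∫ r : Set.Ioi (0 : ℝ), f r ∂(Measure.volumeIoiPow n) =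
      ∫ r in Set.Ioi (0 : ℝ), ((r ^ n : ℝ) : ℂ) * f r := by
  simp only [Measure.volumeIoiPow, ENNReal.ofReal]
  rw [integral_withDensity_eq_integral_smul (by fun_prop),
    ← integral_subtype_comap measurableSet_Ioi (fun r : ℝ => ((r ^ n : ℝ) : ℂ) * f r)]
  refine integral_congr_ae (Eventually.of_forall fun r => ?_)
  simp only [NNReal.smul_def, Real.coe_toNNReal _ (pow_nonneg r.2.out.le n), Complex.real_smul]

/-- An integral is real if the integral over every ray is real. -/
lemma integral_im_eq_zero_of_rays {V : ℕ} (hV : 0 < V) (f : (Fin V → ℝ) → ℂ)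
    (hf : Integrable f)
    (h : ∀ w, (∫ r in Set.Ioi (0 : ℝ), ((r ^ (V - 1) : ℝ) : ℂ) * f (r • w)).im = 0) :
    (∫ x, f x).im = 0 := by
  have : Nonempty (Fin V) := ⟨⟨0, hV⟩⟩
  let μ : Measure (Fin V → ℝ) := volume
  -- The sphere is that of the sup norm on `Fin V → ℝ`; only the radial structure matters.
  have hmp := μ.measurePreserving_homeomorphUnitSphereProd
  have hemb := (homeomorphUnitSphereProd (Fin V → ℝ)).measurableEmbedding
  let g : Metric.sphere (0 : Fin V → ℝ) 1 × Set.Ioi (0 : ℝ) → ℂ := fun y => f ((y.2 : ℝ) • y.1)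
  have hg : ∀ x : ({0}ᶜ : Set (Fin V → ℝ)), g (homeomorphUnitSphereProd _ x) = f x := fun x => by
    have := congrArg Subtype.val ((homeomorphUnitSphereProd (Fin V → ℝ)).symm_apply_apply x)
    rw [homeomorphUnitSphereProd_symm_apply_coe] at this
    simp only [g, this]
  have hint : Integrable g (μ.toSphere.prod (Measure.volumeIoiPow (Module.finrank ℝ (Fin V → ℝ) - 1))) := by
    rw [← hmp.integrable_comp_emb hemb]
    have : g ∘ homeomorphUnitSphereProd (Fin V → ℝ) = f ∘ Subtype.val := funext hg
    rw [this, ← integrableOn_iff_comap_subtypeVal (measurableSet_singleton 0).compl]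
    exact hf.integrableOn
  have heq : ∫ x, f x =
      ∫ y, g y ∂(μ.toSphere.prod (Measure.volumeIoiPow (Module.finrank ℝ (Fin V → ℝ) - 1))) := by
    rw [← hmp.integral_comp hemb]
    simp only [hg]
    rw [integral_subtype_comap (measurableSet_singleton 0).compl f, restrict_compl_singleton]
  -- The radial integrals are rewritten as casts of real numbers, so that the integral over the
  -- sphere is visibly a cast as well.
  have hinner : ∀ w : Metric.sphere (0 : Fin V → ℝ) 1,
      ∫ r, g (w, r) ∂(Measure.volumeIoiPow (Module.finrank ℝ (Fin V → ℝ) - 1)) =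
        ((∫ r in Set.Ioi (0 : ℝ), ((r ^ (V - 1) : ℝ) : ℂ) * f (r • (w : Fin V → ℝ))).re : ℂ) := by
    intro w
    rw [Module.finrank_fin_fun,
      integral_volumeIoiPow (V - 1) (fun r : ℝ => f (r • (w : Fin V → ℝ)))]
    exact Complex.ext rfl (by simpa using h w)
  rw [heq, integral_prod _ hint]
  simp only [hinner]
  exact (congrArg Complex.im (integral_ofReal (𝕜 := ℂ))).trans (Complex.ofReal_im _)

namespace TreeDiagram

variable {ι : Type*} {E : ℕ}

lemma measurableSet_domain (D : TreeDiagram ι E) : MeasurableSet D.domain := by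
  have : D.domain = ⋂ v, {s | 0 < s v} := by ext; simp [domain]
  rw [this]
  exact MeasurableSet.iInter fun v => measurableSet_lt measurable_const (measurable_pi_apply v)

/-- The regularized integral of a diagram with dilation invariant interactions is real. -/
theorem integral_integrand_im (D : TreeDiagram ι E)
    (hD : ∀ v, (D.interaction v).DilationInvariant) (H : ℝ) (θ : StepProfile) {ε : ℝ}
    (hε : 0 < ε) (σ : ℝ) (hint : IntegrableOn (D.integrand H θ ε σ) D.domain) :
    (∫ s in D.domain, D.integrand H θ ε σ s).im = 0 := by
  have hV : 0 < D.V := by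
    obtain ⟨v⟩ := D.isTree.connected.nonempty
    exact v.pos
  have hmeas := D.measurableSet_domain
  rw [← integral_indicator hmeas]
  refine integral_im_eq_zero_of_rays hV _ ((integrable_indicator_iff hmeas).2 hint) fun w => ?_
  have hmem : ∀ r : ℝ, 0 < r → (r • w ∈ D.domain ↔ w ∈ D.domain) := fun r hr =>
    forall_congr' fun v => by simp [hr]
  by_cases hw : w ∈ D.domain
  · obtain ⟨c, hc⟩ := D.exists_integrand_ray hD H θ ε σ hw
    have hEq : Set.EqOn (fun r : ℝ => ((r ^ (D.V - 1) : ℝ) : ℂ) *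
        D.domain.indicator (D.integrand H θ ε σ) (r • w))
        (fun r : ℝ => rayDir ε * expSum c (rayDir ε * r)) (Set.Ioi 0) := fun r hr => by
      dsimp only
      rw [Set.indicator_of_mem ((hmem r hr).2 hw), hc r hr]
    rw [setIntegral_congr_fun measurableSet_Ioi hEq, integral_const_mul]
    -- Absolute convergence gives integrability on almost every ray only; on an exceptional ray the
    -- integral is zero by convention, hence still real.
    by_cases hray : IntegrableOn (fun r : ℝ => expSum c (rayDir ε * r)) (Set.Ioi 0)
    · exact ray_integral_im c (by rwa [rayDir_re]) hray
    · rw [integral_undef hray, mul_zero, Complex.zero_im]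
  · have hEq : Set.EqOn (fun r : ℝ => ((r ^ (D.V - 1) : ℝ) : ℂ) *
        D.domain.indicator (D.integrand H θ ε σ) (r • w)) (fun _ => 0) (Set.Ioi 0) :=
      fun r hr => by
        dsimp only
        rw [Set.indicator_of_notMem (fun h => hw ((hmem r hr).1 h)), mul_zero]
    rw [setIntegral_congr_fun measurableSet_Ioi hEq]
    simp

end TreeDiagram

end DeSitter

end

theorem mainTheorem1 {ι : Type*} (EFT : Set (DeSitter.LocalInteraction ι))
    (hparity : ∀ O ∈ EFT, O.ParityInvariant)
    (hrotation : ∀ O ∈ EFT, O.RotationInvariant)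
    (hdilation : ∀ O ∈ EFT, O.DilationInvariant)
    (H : ℝ) (hH : 0 < H) (θ : DeSitter.StepProfile)
    {E : ℕ} (D : DeSitter.TreeDiagram ι E) (hD : ∀ v, D.interaction v ∈ EFT)
    (ψ : ℂ) (hψ : D.HasValue H θ ψ) :
    ψ.im = 0 := by
  obtain ⟨hint, Ψ, hΨ, hlim⟩ := hψ
  -- The imaginary part is continuous and vanishes before each limit; the condition `ε > 0` puts the
  -- ray in the open right half plane.
  have hreal : ∀ᶠ ε in 𝓝[>] (0 : ℝ), (Ψ ε).im = 0 := by
    filter_upwards [hint, hΨ, self_mem_nhdsWithin] with ε h1 h2 h3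
    refine tendsto_nhds_unique ((Complex.continuous_im.tendsto _).comp h2)
      (tendsto_const_nhds.congr' ?_)
    filter_upwards [h1] with σ hσ
    exact (D.integral_integrand_im (fun v => hdilation _ (hD v)) H θ h3 σ hσ).symm
  refine tendsto_nhds_unique ((Complex.continuous_im.tendsto _).comp hlim)
    (tendsto_const_nhds.congr' ?_)
  filter_upwards [hreal] with ε hε using hε.symm
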